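/- Let $(\mathcal M,g)$ be a compact smooth Riemannian manifold (without boundary) of dimension $d\ge 1$, with Riemannian volume $\operatorname{vol}_g$ normalised so that $\operatorname{vol}_g(\mathcal M)=1$, and with geodesic distance $\operatorname{dist}_g$ (set to $\infty$ between different connected components). Let $\xi=(\xi_{ij})$, $i\in\mathbb N$, $1\le j\le N_i$, be a triangular array of points $\xi_{ij}\in\mathcal M$, where $N_i$ are positive integers with $N_i<N_{i+1}$. We say that $\xi$ is equidistributed in $(\mathcal M,\operatorname{vol}_g)$ if $$\lim_{i\to\infty}\frac1{N_i}\sum_{j=1}^{N_i} f(\xi_{ij})=\int_{\mathcal M} f\,d\operatorname{vol}_g\qquad\text{for every bounded continuous } f:\mathcal M\to\mathbb R .$$ For a sequence $M=(M_i)$ of positive real numbers, the pair correlation measure $\rho_i^{(g)}$ on $\mathbb R_{\ge 0}$ is defined by $$\rho_i^{(g)} h=\frac{M_i}{N_i^2}\sum_{\substack{j_1,j_2=1\\ j_1\ne j_2}}^{N_i} h\big(M_i^{1/d}\operatorname{dist}_g(\xi_{ij_1},\xi_{ij_2})\big),\qquad h\in C_c^+(\mathbb R_{\ge 0}),$$ where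 $C_c^+(\mathbb R_{\ge 0})$ is the set of non-negative continuous functions with compact support on $\mathbb R_{\ge0}$, and $h(\infty)=0$. Let $\omega$ be the Borel measure on $\mathbb R_{\ge 0}$ with $\omega[0,r]=r^d\operatorname{vol}B_1^d$ for all $r\ge0$, where $\operatorname{vol}B_1^d$ is the Lebesgue measure of the unit ball in $\mathbb R^d$. We say that $\rho_i^{(g)}$ has a Poisson limit for the scaling $M$ if $\lim_{i\to\infty}\rho_i^{(g)}h=\omega h$ for every $h\in C_c^+(\mathbb R_{\ge 0})$, and a sub-Poisson limit if $\limsup_{i\to\infty}\rho_i^{(g)}h\le\omega h$ for every $h\in C_c^+(\mathbb R_{\ge 0})$. (i) Suppose there is a nondecreasing sequence $M$ of positive reals with $M_i\to\infty$ and $M_i\le N_i$ such that $\rho_i^{(g)}$ has a sub-Poisson limit for the scaling $M$. Then $\xi$ is equidistributed in $(\mathcal M,\operatorname{vol}_g)$. (ii) Suppose $\xi$ is equidistributed in $(\mathcal M,\operatorname{vol}_g)$. Then there is a strictly increasing sequence $M$ of positive reals with $M_i\to\infty$ and $M_i\le N_i$ such that $\rho_i^{(g)}$ has a Poisson limit for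 the scaling $M$. -/

import Mathlib

open Set Filter Topology MeasureTheory Manifold Bundle
open scoped NNReal ENNReal ContDiff CompactlySupported BoundedContinuousFunction

noncomputable section

namespace PairCorrelation

section Volume

/-- The Gram matrix `g(dψ(b_i), dψ(b_j))` at `ψ u`, for a map `ψ` from the model vector space `E`
to a manifold `X` with a Riemannian metric `g`, and vectors `b_i` in `E`. -/
def gramMatrix {E : Type*} [NormedAddCommGroup E] [NormedSpace ℝ E]
    {X : Type*} [TopologicalSpace X] [ChartedSpace E X]
    [RiemannianBundle (fun x : X ↦ TangentSpace 𝓘(ℝ, E) x)]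
    {ι : Type*} (b : ι → E) (ψ : E → X) (u : E) : Matrix ι ι ℝ :=
  Matrix.of fun i j ↦
    inner ℝ (mfderiv 𝓘(ℝ, E) 𝓘(ℝ, E) ψ u (b i) : TangentSpace 𝓘(ℝ, E) (ψ u))
      (mfderiv 𝓘(ℝ, E) 𝓘(ℝ, E) ψ u (b j) : TangentSpace 𝓘(ℝ, E) (ψ u))

variable (d : ℕ) {X : Type*} [TopologicalSpace X] [ChartedSpace (EuclideanSpace ℝ (Fin d)) X]
  [RiemannianBundle (fun x : X ↦ TangentSpace (𝓡 d) x)]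

/-- The matrix `g_ij(u) = g(∂_i, ∂_j)` of the Riemannian metric in the chart `φ` at `x₀`,
as a function of the coordinate `u`. The coordinate vector field `∂_i` is the image of the
`i`-th standard basis vector under the derivative of `φ⁻¹`. -/
def metricMatrix (x₀ : X) (u : EuclideanSpace ℝ (Fin d)) : Matrix (Fin d) (Fin d) ℝ :=
  gramMatrix (fun i ↦ EuclideanSpace.single i (1 : ℝ))
    (chartAt (EuclideanSpace ℝ (Fin d)) x₀).symm u

/-- The Riemannian volume of the domain of the chart `φ` at `x₀`: the image under `φ⁻¹` of
`√(det g_ij(u)) du` on the target of `φ`. -/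
def chartVolume [MeasurableSpace X] (x₀ : X) : Measure X :=
  ((volume.restrict (chartAt (EuclideanSpace ℝ (Fin d)) x₀).target).withDensity
    fun u ↦ ENNReal.ofReal √(metricMatrix d x₀ u).det).map
      (chartAt (EuclideanSpace ℝ (Fin d)) x₀).symm

/-- In formulas, `chartVolume d x₀ A` is the integral of `√(det g_ij)` over `φ (A ∩ dom φ)`. -/
theorem chartVolume_apply [MeasurableSpace X] [BorelSpace X] (x₀ : X) {A : Set X}
    (hA : MeasurableSet A) :
    chartVolume d x₀ A = ∫⁻ u in (chartAt (EuclideanSpace ℝ (Fin d)) x₀).target ∩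
      (chartAt (EuclideanSpace ℝ (Fin d)) x₀).symm ⁻¹' A,
        ENNReal.ofReal √(metricMatrix d x₀ u).det := by
  set φ := chartAt (EuclideanSpace ℝ (Fin d)) x₀ with hφ
  have hT : MeasurableSet φ.target := φ.open_target.measurableSet
  have h1 : AEMeasurable φ.symm (volume.restrict φ.target) :=
    φ.continuousOn_symm.aemeasurable hT
  have h2 : AEMeasurable φ.symm ((volume.restrict φ.target).withDensity
      fun u ↦ ENNReal.ofReal √(metricMatrix d x₀ u).det) :=
    h1.mono_ac (withDensity_absolutelyContinuous _ _)
  have h3 : MeasurableSet (φ.target ∩ φ.symm ⁻¹' A) := by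
    have h4 : Measurable (φ.target.domRestrict φ.symm) :=
      φ.continuousOn_symm.domRestrict.measurable
    have h5 := hT.subtype_image (h4 hA)
    convert h5 using 1
    ext u
    simp [Set.domRestrict, and_comm]
  rw [chartVolume, ← hφ, Measure.map_apply_of_aemeasurable h2 hA]
  have h6 : ((volume.restrict φ.target).withDensity
      fun u ↦ ENNReal.ofReal √(metricMatrix d x₀ u).det) (φ.symm ⁻¹' A) =
      ((volume.restrict φ.target).withDensity
      fun u ↦ ENNReal.ofReal √(metricMatrix d x₀ u).det) (φ.target ∩ φ.symm ⁻¹' A) := by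
    apply measure_congr
    have h7 : ∀ᵐ u ∂((volume.restrict φ.target).withDensity
        fun u ↦ ENNReal.ofReal √(metricMatrix d x₀ u).det), u ∈ φ.target :=
      (withDensity_absolutelyContinuous _ _).ae_le (ae_restrict_mem hT)
    filter_upwards [h7] with u hu
    exact propext ⟨fun h ↦ ⟨hu, h⟩, fun h ↦ h.2⟩
  rw [h6, withDensity_apply _ h3, Measure.restrict_restrict h3,
    Set.inter_eq_left.2 Set.inter_subset_left]

variable (X) in
/-- The Riemannian volume measure `vol_g`. The chart volumes agree on the overlaps of chart
domains (change of variables), and `vol_g` is obtained by gluing them: it is the smallest measure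
on `X` that dominates each of them, which, on a manifold covered by countably many charts, is the
measure that restricts to `chartVolume d x₀` on the domain of the chart at each `x₀`. -/
def riemannianVolume [MeasurableSpace X] : Measure X :=
  ⨆ x₀ : X, chartVolume d x₀

end Volume

/-- A triangular array with entries in `X`: finite rows of strictly increasing positive lengths
`N 0 < N 1 < ⋯`. -/
structure TriangularArray (X : Type*) where
  /-- the length of the `i`-th row -/
  N : ℕ → ℕ
  N_pos : ∀ i, 0 < N i
  N_strictMono : StrictMono N
  /-- the `j`-th entry of the `i`-th row -/
  pt : ∀ i, Fin (N i) → X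

/-- The array `ξ` is equidistributed in `(X, σ)`: the averages over its rows of every bounded
continuous function converge to the integral of the function. -/
def TriangularArray.Equidistributed {X : Type*} [TopologicalSpace X] [MeasurableSpace X]
    (ξ : TriangularArray X) (σ : Measure X) : Prop :=
  ∀ f : X →ᵇ ℝ, Tendsto (fun i ↦ (1 / (ξ.N i : ℝ)) * ∑ j, f (ξ.pt i j)) atTop (𝓝 (∫ x, f x ∂σ))

open scoped Classical in
/-- The pair correlation measure of the `i`-th row at scale `s`, in dimension `d`:
`s / N² * ∑ δ(s^(1/d) * dist(ξ_j₁, ξ_j₂))`, the sum over the pairs `j₁ ≠ j₂`, for the distance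
of `X` (the geodesic distance when `X` is a Riemannian manifold). Points in different connected
components have infinite distance and do not contribute. -/
def TriangularArray.pairCorrelation {X : Type*} [EMetricSpace X] (ξ : TriangularArray X)
    (d : ℕ) (s : ℝ≥0) (i : ℕ) : Measure ℝ≥0 :=
  (s / (ξ.N i : ℝ≥0) ^ 2) •
    ∑ p : Fin (ξ.N i) × Fin (ξ.N i) with p.1 ≠ p.2 ∧ edist (ξ.pt i p.1) (ξ.pt i p.2) ≠ ⊤,
      Measure.dirac (s ^ (1 / (d : ℝ)) * (edist (ξ.pt i p.1) (ξ.pt i p.2)).toNNReal)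

/-- The Borel measure `ω` on `[0, ∞)` with `ω [0, r] = r ^ d * vol B_1`, as the image of Lebesgue
measure on `ℝ^d` under the Euclidean norm. -/
def poissonMeasure (d : ℕ) : Measure ℝ≥0 :=
  (volume : Measure (EuclideanSpace ℝ (Fin d))).map fun x ↦ ‖x‖₊

theorem poissonMeasure_Icc (d : ℕ) (r : ℝ≥0) :
    poissonMeasure d (Icc 0 r) =
      (r : ℝ≥0∞) ^ d * volume (Metric.ball (0 : EuclideanSpace ℝ (Fin d)) 1) := by
  rw [poissonMeasure, Measure.map_apply measurable_nnnorm measurableSet_Icc]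
  have h : (fun x : EuclideanSpace ℝ (Fin d) ↦ ‖x‖₊) ⁻¹' Icc 0 r =
      Metric.closedBall 0 (r : ℝ) := by
    ext x
    simp [← NNReal.coe_le_coe]
  rw [h, Measure.addHaar_closedBall _ _ r.coe_nonneg, finrank_euclideanSpace, Fintype.card_fin,
    ENNReal.ofReal_pow r.coe_nonneg, ENNReal.ofReal_coe_nnreal]

/-- Vague convergence of `ρ i` to the Poisson measure `ω`, tested on the nonnegative continuous
functions with compact support in `[0, ∞)`. -/
def HasPoissonLimit (d : ℕ) (ρ : ℕ → Measure ℝ≥0) : Prop :=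
  ∀ h : C_c(ℝ≥0, ℝ≥0),
    Tendsto (fun i ↦ ∫⁻ t, (h t : ℝ≥0∞) ∂(ρ i)) atTop (𝓝 (∫⁻ t, (h t : ℝ≥0∞) ∂(poissonMeasure d)))

/-- `limsup ρ_i h ≤ ω h` for all nonnegative continuous `h` with compact support in `[0, ∞)`. -/
def HasSubPoissonLimit (d : ℕ) (ρ : ℕ → Measure ℝ≥0) : Prop :=
  ∀ h : C_c(ℝ≥0, ℝ≥0),
    limsup (fun i ↦ ∫⁻ t, (h t : ℝ≥0∞) ∂(ρ i)) atTop ≤ ∫⁻ t, (h t : ℝ≥0∞) ∂(poissonMeasure d)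

end PairCorrelation

end

set_option linter.unusedSectionVars false

namespace PairCorrelation

/-! Geometry enters through one property, `LocallyAlmostEuclidean`. Composing a chart with the
linear map that makes the metric at its centre Euclidean gives coordinates which, near the centre,
distort distances and volumes by factors as close to 1 as desired. With compactness this yields (σ ×
σ){dist ≤ t} ~ t^d vol B_1 as t → 0 (`tendsto_pairMass`).

Equidistribution implies a Poisson limit. Let μ_i be the uniform measure on row i. Then μ_i → σ
weakly, hence μ_i × μ_i → σ × σ, and the laws of the distance, truncated at 1, converge on ℝ. Their
Lévy–Prokhorov distance tends to 0, so the distribution functions of the distance agree up to errors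
ε_i → 0 in argument and value (`exists_levy_sequence`). If the scale s_i stays below ε_i^(-1/2),
then s_i ε_i, s_i^(1/d) ε_i and the diagonal term s_i / N_i all vanish in the limit, and the
asymptotics of σ × σ near the diagonal give ω.

A sub-Poisson limit implies equidistribution. This is an L² argument: smear each point over a ball
of radius R s^(-1/d). The squared norm of the resulting density is a pair sum whose kernel is the
overlap of two balls (`ballOverlap`). Its off-diagonal part is asymptotically at most nearly 1 by
hypothesis, and its diagonal part is at most 1/(R^d vol B_1), small for large R. Expanding ∫ (f -
density)² ≥ 0 gives 2 avg f ≤ ∫ f² + 1 + ε for every continuous f (`eventually_two_mul_average_le`).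
Applying this to f = 1 + t g with ∫ g = 0 and t small forces limsup avg g ≤ 0; the same for -g gives
convergence.

The smearing is done in charts, glued by functions χ_a with Σ χ_a² = 1. Since Σ χ_a(x) χ_a(y) ≤ 1,
the local pair sums add up to at most the global one. Since the overlap decreases with the distance
of the centres (`ballOverlap_anti`), chart distances can be replaced by geodesic ones. -/

theorem enorm_le_mul_enorm_of_norm_le {E F : Type*} [SeminormedAddGroup E] [SeminormedAddGroup F]
    {r : ℝ≥0} {a : E} {b : F} (h : ‖a‖ ≤ r * ‖b‖) : ‖a‖ₑ ≤ r * ‖b‖ₑ := by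
  rw [← ofReal_norm, ← ofReal_norm, ← ENNReal.ofReal_coe_nnreal, ← ENNReal.ofReal_mul r.coe_nonneg]
  exact ENNReal.ofReal_le_ofReal h

/-! ### First-order behaviour of charts and lengths of curves -/

section Tangent

variable {d : ℕ} {X : Type*} [TopologicalSpace X] [ChartedSpace (EuclideanSpace ℝ (Fin d)) X]

theorem isContinuousRiemannianBundle_of_isContMDiff [IsManifold (𝓡 d) ∞ X]
    [RiemannianBundle (fun x : X ↦ TangentSpace (𝓡 d) x)]
    [h : IsContMDiffRiemannianBundle (𝓡 d) ∞ (EuclideanSpace ℝ (Fin d))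
      (fun x : X ↦ TangentSpace (𝓡 d) x)] :
    IsContinuousRiemannianBundle (EuclideanSpace ℝ (Fin d))
      (fun x : X ↦ TangentSpace (𝓡 d) x) := by
  obtain ⟨g, hg, hgi⟩ := h.exists_contMDiff
  exact ⟨g, hg.continuous, hgi⟩

theorem exists_linearIsometryEquiv_tangentSpace
    [RiemannianBundle (fun x : X ↦ TangentSpace (𝓡 d) x)] (x : X) :
    Nonempty (TangentSpace (𝓡 d) x ≃ₗᵢ[ℝ] EuclideanSpace ℝ (Fin d)) := by
  have : FiniteDimensional ℝ (TangentSpace (𝓡 d) x) :=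
    inferInstanceAs (FiniteDimensional ℝ (EuclideanSpace ℝ (Fin d)))
  have h : Module.finrank ℝ (TangentSpace (𝓡 d) x) = d := by
    have : Module.finrank ℝ (EuclideanSpace ℝ (Fin d)) = d := by simp
    exact this
  exact ⟨((stdOrthonormalBasis ℝ (TangentSpace (𝓡 d) x)).reindex (finCongr h)).repr⟩

variable [IsManifold (𝓡 d) 1 X]

theorem symmL_trivializationAt_apply {x₀ : X} {u : EuclideanSpace ℝ (Fin d)}
    (hu : u ∈ (chartAt (EuclideanSpace ℝ (Fin d)) x₀).target) (v : EuclideanSpace ℝ (Fin d)) :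
    (trivializationAt (EuclideanSpace ℝ (Fin d)) (fun x : X ↦ TangentSpace (𝓡 d) x) x₀).symmL ℝ
      ((chartAt (EuclideanSpace ℝ (Fin d)) x₀).symm u) v =
    mfderiv (𝓡 d) (𝓡 d) (chartAt (EuclideanSpace ℝ (Fin d)) x₀).symm u v := by
  have h := TangentBundle.symmL_trivializationAt (I := 𝓡 d) (𝕜 := ℝ)
    ((chartAt (EuclideanSpace ℝ (Fin d)) x₀).map_target hu)
  rw [h]
  simp only [mfld_simps, mfderivWithin_univ]
  exact congrArg (fun u' ↦ (mfderiv (𝓡 d) (𝓡 d) (chartAt (EuclideanSpace ℝ (Fin d)) x₀).symm u' :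
    EuclideanSpace ℝ (Fin d) →L[ℝ] EuclideanSpace ℝ (Fin d)) v)
    ((chartAt (EuclideanSpace ℝ (Fin d)) x₀).right_inv hu)

theorem continuousLinearMapAt_trivializationAt_apply {x₀ y : X}
    (hy : y ∈ (chartAt (EuclideanSpace ℝ (Fin d)) x₀).source) (v : TangentSpace (𝓡 d) y) :
    (trivializationAt (EuclideanSpace ℝ (Fin d)) (fun x : X ↦ TangentSpace (𝓡 d) x)
      x₀).continuousLinearMapAt ℝ y v =
    mfderiv (𝓡 d) (𝓡 d) (chartAt (EuclideanSpace ℝ (Fin d)) x₀) y v := by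
  rw [TangentBundle.continuousLinearMapAt_trivializationAt (I := 𝓡 d) (𝕜 := ℝ) hy]
  simp only [mfld_simps]
  rfl

variable [RiemannianBundle (fun x : X ↦ TangentSpace (𝓡 d) x)]
  [IsContinuousRiemannianBundle (EuclideanSpace ℝ (Fin d))
    (fun x : X ↦ TangentSpace (𝓡 d) x)]

/-- After a linear change of coordinates, the chart at `x₀` is almost isometric to first order
near `x₀`. -/
theorem exists_chart_normalization (x₀ : X) :
    ∃ L : EuclideanSpace ℝ (Fin d) ≃L[ℝ] EuclideanSpace ℝ (Fin d), ∀ r : ℝ≥0, 1 < r →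
      (∀ᶠ y in 𝓝 x₀, ∀ w : TangentSpace (𝓡 d) y,
        ‖L (mfderiv (𝓡 d) (𝓡 d) (chartAt (EuclideanSpace ℝ (Fin d)) x₀) y w)‖ₑ ≤ r * ‖w‖ₑ) ∧
      (∀ᶠ u in 𝓝 (chartAt (EuclideanSpace ℝ (Fin d)) x₀ x₀), ∀ v : EuclideanSpace ℝ (Fin d),
        ‖mfderiv (𝓡 d) (𝓡 d) (chartAt (EuclideanSpace ℝ (Fin d)) x₀).symm u v‖ₑ
          ≤ r * ‖L v‖ₑ) := by
  set φ := chartAt (EuclideanSpace ℝ (Fin d)) x₀ with hφ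
  set e := trivializationAt (EuclideanSpace ℝ (Fin d)) (fun x : X ↦ TangentSpace (𝓡 d) x) x₀
    with he
  obtain ⟨ι⟩ := exists_linearIsometryEquiv_tangentSpace (d := d) x₀
  have hx₀ : x₀ ∈ e.baseSet := FiberBundle.mem_baseSet_trivializationAt' x₀
  have hs : φ.source ∈ 𝓝 x₀ := chart_source_mem_nhds _ x₀
  have hL (v : EuclideanSpace ℝ (Fin d)) : ((e.continuousLinearEquivAt ℝ x₀ hx₀).symm.trans
      ι.toContinuousLinearEquiv) v = ι (e.symmL ℝ x₀ v) := by
    rw [ContinuousLinearEquiv.trans_apply, e.symm_continuousLinearEquivAt_eq hx₀]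
    rfl
  -- Coordinate vectors are read in the tangent space at x₀ with its own inner product, then
  -- identified isometrically with ℝ^d. Both bounds express continuity of the metric at x₀.
  refine ⟨(e.continuousLinearEquivAt ℝ x₀ hx₀).symm.trans ι.toContinuousLinearEquiv,
    fun r hr ↦ ⟨?_, ?_⟩⟩
  · filter_upwards [eventually_norm_symmL_trivializationAt_self_comp_lt (EuclideanSpace ℝ (Fin d))
      (fun x : X ↦ TangentSpace (𝓡 d) x) x₀ (r := r) (by exact_mod_cast hr), hs] with y hy hys w
    have h1 := (ContinuousLinearMap.le_opNorm _ w).trans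
      (mul_le_mul_of_nonneg_right hy.le (norm_nonneg w))
    rw [ContinuousLinearMap.comp_apply, continuousLinearMapAt_trivializationAt_apply hys] at h1
    have h2 : ‖ι (e.symmL ℝ x₀ (mfderiv (𝓡 d) (𝓡 d) φ y w))‖ ≤ r * ‖w‖ := by
      rw [ι.norm_map]; exact h1
    exact enorm_le_mul_enorm_of_norm_le ((congrArg norm (hL _)).trans_le h2)
  · have hc : ContinuousAt φ.symm (φ x₀) := φ.continuousAt_symm (mem_chart_target _ x₀)
    have h0 : φ.symm (φ x₀) = x₀ := φ.left_inv (mem_chart_source _ x₀)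
    have h1 := eventually_norm_symmL_trivializationAt_comp_self_lt (EuclideanSpace ℝ (Fin d))
      (fun x : X ↦ TangentSpace (𝓡 d) x) x₀ (r := r) (by exact_mod_cast hr)
    rw [ContinuousAt, h0] at hc
    filter_upwards [hc.eventually h1, chart_target_mem_nhds _ x₀] with u hu hut v
    have h2 := (ContinuousLinearMap.le_opNorm _ (e.symmL ℝ x₀ v)).trans
      (mul_le_mul_of_nonneg_right hu.le (norm_nonneg _))
    rw [ContinuousLinearMap.comp_apply, e.continuousLinearMapAt_symmL hx₀,
      symmL_trivializationAt_apply hut, ← ι.norm_map] at h2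
    exact enorm_le_mul_enorm_of_norm_le (h2.trans_eq (by rw [hL]))

omit [IsContinuousRiemannianBundle (EuclideanSpace ℝ (Fin d))
    (fun x : X ↦ TangentSpace (𝓡 d) x)] in
-- The chain rule bounds the speed of the image curve by r times the speed of γ, and a chord is no
-- longer than its curve.
theorem edist_chart_le_pathELength {x₀ : X}
    {L : EuclideanSpace ℝ (Fin d) ≃L[ℝ] EuclideanSpace ℝ (Fin d)} {r : ℝ≥0} {S : Set X}
    (hS : S ⊆ (chartAt (EuclideanSpace ℝ (Fin d)) x₀).source)
    (hL : ∀ y ∈ S, ∀ w : TangentSpace (𝓡 d) y,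
      ‖L (mfderiv (𝓡 d) (𝓡 d) (chartAt (EuclideanSpace ℝ (Fin d)) x₀) y w)‖ₑ ≤ r * ‖w‖ₑ)
    {γ : ℝ → X} (hγ : ContMDiffOn 𝓘(ℝ, ℝ) (𝓡 d) 1 γ (Icc 0 1)) (hγS : MapsTo γ (Icc 0 1) S) :
    edist (L (chartAt (EuclideanSpace ℝ (Fin d)) x₀ (γ 0)))
      (L (chartAt (EuclideanSpace ℝ (Fin d)) x₀ (γ 1))) ≤ r * pathELength (𝓡 d) γ 0 1 := by
  set φ := chartAt (EuclideanSpace ℝ (Fin d)) x₀ with hφ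
  have hφc : ContMDiffOn (𝓡 d) (𝓡 d) 1 φ φ.source := contMDiffOn_chart
  have hc : ContMDiffOn 𝓘(ℝ, ℝ) (𝓡 d) 1 (φ ∘ γ) (Icc 0 1) :=
    hφc.comp hγ (fun t ht ↦ hS (hγS ht))
  have hc' : ContDiffOn ℝ 1 (fun t ↦ L (φ (γ t))) (Icc 0 1) :=
    L.contDiff.comp_contDiffOn (contMDiffOn_iff_contDiffOn.1 hc)
  rw [edist_comm, edist_eq_enorm_sub]
  refine (enorm_sub_le_lintegral_derivWithin_Icc_of_contDiffOn_Icc hc' zero_le_one).trans ?_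
  rw [pathELength_eq_lintegral_mfderivWithin_Icc, ← lintegral_const_mul' _ _ ENNReal.coe_ne_top]
  refine setLIntegral_mono' measurableSet_Icc fun t ht ↦ ?_
  have hu : UniqueDiffWithinAt ℝ (Icc (0 : ℝ) 1) t := uniqueDiffOn_Icc zero_lt_one t ht
  have h1 : derivWithin (fun t ↦ L (φ (γ t))) (Icc 0 1) t =
      L (derivWithin (φ ∘ γ) (Icc 0 1) t) := by
    have h2 : DifferentiableWithinAt ℝ (φ ∘ γ) (Icc 0 1) t :=
      (contMDiffOn_iff_contDiffOn.1 hc).differentiableOn one_ne_zero t ht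
    exact (L.hasFDerivAt.comp_hasDerivWithinAt t h2.hasDerivWithinAt).derivWithin hu
  have h3 : mfderivWithin 𝓘(ℝ, ℝ) (𝓡 d) (φ ∘ γ) (Icc 0 1) t =
      (mfderiv (𝓡 d) (𝓡 d) φ (γ t)) ∘L (mfderivWithin 𝓘(ℝ, ℝ) (𝓡 d) γ (Icc 0 1) t) := by
    apply mfderiv_comp_mfderivWithin
    · exact mdifferentiableAt_atlas (chart_mem_atlas _ x₀) (hS (hγS ht))
    · exact hγ.mdifferentiableOn one_ne_zero t ht
    · exact uniqueMDiffWithinAt_iff_uniqueDiffWithinAt.2 hu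
  have h4 : derivWithin (φ ∘ γ) (Icc 0 1) t =
      mfderiv (𝓡 d) (𝓡 d) φ (γ t) (mfderivWithin 𝓘(ℝ, ℝ) (𝓡 d) γ (Icc 0 1) t 1) := by
    rw [← fderivWithin_derivWithin, ← mfderivWithin_eq_fderivWithin]
    exact congrArg (fun A : ℝ →L[ℝ] EuclideanSpace ℝ (Fin d) ↦ A 1) h3
  rw [h1, h4]
  exact hL _ (hγS ht) _

omit [IsContinuousRiemannianBundle (EuclideanSpace ℝ (Fin d))
    (fun x : X ↦ TangentSpace (𝓡 d) x)] in
-- The straight segment in the convex set C is mapped by the inverse chart to a competitor for the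
-- geodesic distance.
theorem riemannianEDist_chart_symm_le {x₀ : X}
    {L : EuclideanSpace ℝ (Fin d) ≃L[ℝ] EuclideanSpace ℝ (Fin d)} {r : ℝ≥0}
    {C : Set (EuclideanSpace ℝ (Fin d))} (hC : Convex ℝ C)
    (hCt : C ⊆ (chartAt (EuclideanSpace ℝ (Fin d)) x₀).target)
    (hL : ∀ u ∈ C, ∀ v : EuclideanSpace ℝ (Fin d),
      ‖mfderiv (𝓡 d) (𝓡 d) (chartAt (EuclideanSpace ℝ (Fin d)) x₀).symm u v‖ₑ ≤ r * ‖L v‖ₑ)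
    {u u' : EuclideanSpace ℝ (Fin d)} (hu : u ∈ C) (hu' : u' ∈ C) :
    riemannianEDist (𝓡 d) ((chartAt (EuclideanSpace ℝ (Fin d)) x₀).symm u)
      ((chartAt (EuclideanSpace ℝ (Fin d)) x₀).symm u') ≤ r * edist (L u) (L u') := by
  set φ := chartAt (EuclideanSpace ℝ (Fin d)) x₀ with hφ
  let η := ContinuousAffineMap.lineMap (R := ℝ) u u'
  have hη : MapsTo η (Icc 0 1) C := by
    intro t ht
    have := hC.segment_subset hu hu'
    rw [segment_eq_image_lineMap] at this
    exact this ⟨t, ht, by simp [η, ContinuousAffineMap.coe_lineMap_eq]⟩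
  have η_smooth : ContMDiffOn 𝓘(ℝ, ℝ) (𝓡 d) 1 η (Icc 0 1) :=
    (contMDiff_iff_contDiff.2 η.contDiff).contMDiffOn
  have hφc : ContMDiffOn (𝓡 d) (𝓡 d) 1 φ.symm φ.target := contMDiffOn_chart_symm
  have h1 : riemannianEDist (𝓡 d) (φ.symm u) (φ.symm u') ≤
      pathELength (𝓡 d) (φ.symm ∘ η) 0 1 := by
    apply riemannianEDist_le_pathELength _ _ _ zero_le_one
    · exact hφc.comp η_smooth fun t ht ↦ hCt (hη ht)
    · simp [η, ContinuousAffineMap.coe_lineMap_eq]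
    · simp [η, ContinuousAffineMap.coe_lineMap_eq]
  refine h1.trans ?_
  rw [pathELength_eq_lintegral_mfderivWithin_Icc]
  have h2 : ∫⁻ t in Icc (0 : ℝ) 1, (r : ℝ≥0∞) * edist (L u) (L u') = r * edist (L u) (L u') := by
    simp
  rw [← h2]
  refine setLIntegral_mono' measurableSet_Icc fun t ht ↦ ?_
  have hud : UniqueDiffWithinAt ℝ (Icc (0 : ℝ) 1) t := uniqueDiffOn_Icc zero_lt_one t ht
  have h3 : mfderivWithin 𝓘(ℝ, ℝ) (𝓡 d) (φ.symm ∘ η) (Icc 0 1) t =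
      (mfderiv (𝓡 d) (𝓡 d) φ.symm (η t)) ∘L (mfderivWithin 𝓘(ℝ, ℝ) (𝓡 d) η (Icc 0 1) t) := by
    apply mfderiv_comp_mfderivWithin
    · exact mdifferentiableAt_atlas_symm (chart_mem_atlas _ x₀) (hCt (hη ht))
    · exact η_smooth.mdifferentiableOn one_ne_zero t ht
    · exact uniqueMDiffWithinAt_iff_uniqueDiffWithinAt.2 hud
  have h4 : mfderivWithin 𝓘(ℝ, ℝ) (𝓡 d) η (Icc 0 1) t 1 = u' - u := by
    rw [mfderivWithin_eq_fderivWithin, fderivWithin_eq_fderiv hud η.differentiableAt]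
    change fderiv ℝ (ContinuousAffineMap.lineMap (R := ℝ) u u') t 1 = _
    simp
  have h5 : mfderivWithin 𝓘(ℝ, ℝ) (𝓡 d) (φ.symm ∘ η) (Icc 0 1) t 1 =
      mfderiv (𝓡 d) (𝓡 d) φ.symm (η t) (u' - u) := by
    rw [h3, ContinuousLinearMap.comp_apply]
    exact congrArg _ h4
  rw [h5, edist_comm, edist_eq_enorm_sub, ← map_sub]
  exact hL _ (hη ht) _

end Tangent

/-! ### Charts are locally almost isometric -/

section Distance

variable {d : ℕ} {X : Type*} [EMetricSpace X] [ChartedSpace (EuclideanSpace ℝ (Fin d)) X]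
  [IsManifold (𝓡 d) 1 X] [RiemannianBundle (fun x : X ↦ TangentSpace (𝓡 d) x)]
  [IsRiemannianManifold (𝓡 d) X]

omit [IsManifold (𝓡 d) 1 X] in
theorem edist_le_pathELength {γ : ℝ → X} (hγ : ContMDiffOn 𝓘(ℝ, ℝ) (𝓡 d) 1 γ (Icc 0 1))
    {t : ℝ} (ht : t ∈ Icc (0 : ℝ) 1) : edist (γ 0) (γ t) ≤ pathELength (𝓡 d) γ 0 1 := by
  rw [IsRiemannianManifold.out (I := 𝓡 d) (γ 0) (γ t)]
  refine (riemannianEDist_le_pathELength (hγ.mono (Icc_subset_Icc_right ht.2)) rfl rfl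
    ht.1).trans (pathELength_mono le_rfl ht.2)

/-- The chart at `x₀`, in suitable linear coordinates, is almost an isometry near `x₀`. -/
theorem eventually_edist_chart_le {x₀ : X}
    {L : EuclideanSpace ℝ (Fin d) ≃L[ℝ] EuclideanSpace ℝ (Fin d)} {r : ℝ≥0}
    (hL : ∀ᶠ y in 𝓝 x₀, ∀ w : TangentSpace (𝓡 d) y,
      ‖L (mfderiv (𝓡 d) (𝓡 d) (chartAt (EuclideanSpace ℝ (Fin d)) x₀) y w)‖ₑ ≤ r * ‖w‖ₑ) :
    ∃ U ∈ 𝓝 x₀, ∀ x ∈ U, ∀ y ∈ U,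
      edist (L (chartAt (EuclideanSpace ℝ (Fin d)) x₀ x))
        (L (chartAt (EuclideanSpace ℝ (Fin d)) x₀ y)) ≤ r * edist x y := by
  obtain ⟨δ, hδ, hball⟩ := EMetric.mem_nhds_iff.1
    (inter_mem (chart_source_mem_nhds (EuclideanSpace ℝ (Fin d)) x₀) hL)
  have hδ3 : 0 < δ / 3 := ENNReal.div_pos hδ.ne' (by simp)
  have hadd : δ / 3 + (δ / 3 + δ / 3) = δ := by rw [← add_assoc]; exact ENNReal.add_thirds δ
  refine ⟨Metric.eball x₀ (δ / 3), Metric.eball_mem_nhds _ hδ3, fun x hx y hy ↦ ?_⟩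
  rw [Metric.mem_eball] at hx hy
  have hxy : edist x y < δ / 3 + δ / 3 :=
    (edist_triangle_right x y x₀).trans_lt (ENNReal.add_lt_add hx hy)
  -- For any c above the distance there is a curve shorter than c. Capping its length at 2δ/3 keeps
  -- it, from its start within δ/3 of x₀, inside the δ-ball where the derivative bound holds.
  have key : ∀ c, edist x y < c → edist (L (chartAt (EuclideanSpace ℝ (Fin d)) x₀ x))
        (L (chartAt (EuclideanSpace ℝ (Fin d)) x₀ y)) ≤ r * c := by
    intro c hc
    have hc' : riemannianEDist (𝓡 d) x y < min c (δ / 3 + δ / 3) := by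
      rw [← IsRiemannianManifold.out (I := 𝓡 d) x y]
      exact lt_min hc hxy
    obtain ⟨γ, h0, h1, hγ, hlen⟩ := exists_lt_of_riemannianEDist_lt hc'
    have hmaps : MapsTo γ (Icc 0 1) (Metric.eball x₀ δ) := by
      intro t ht
      rw [Metric.mem_eball, edist_comm]
      calc edist x₀ (γ t) ≤ edist x₀ x + edist x (γ t) := edist_triangle _ _ _
        _ < δ / 3 + (δ / 3 + δ / 3) := by
          refine ENNReal.add_lt_add (by rwa [edist_comm]) ?_
          rw [← h0]
          exact (edist_le_pathELength hγ ht).trans_lt (hlen.trans_le (min_le_right _ _))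
        _ = δ := hadd
    have := edist_chart_le_pathELength (L := L) (r := r) (S := Metric.eball x₀ δ)
      (fun z hz ↦ (hball hz).1) (fun z hz ↦ (hball hz).2) hγ hmaps
    rw [h0, h1] at this
    exact this.trans (by gcongr; exact hlen.le.trans (min_le_left _ _))
  by_cases hr : r = 0
  · subst hr
    simpa using key _ hxy
  have h2 : edist (L (chartAt (EuclideanSpace ℝ (Fin d)) x₀ x))
      (L (chartAt (EuclideanSpace ℝ (Fin d)) x₀ y)) / r ≤ edist x y := by
    refine le_of_forall_gt fun c hc ↦ ?_
    obtain ⟨c', hc1, hc2⟩ := exists_between hc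
    exact (ENNReal.div_le_of_le_mul' (key c' hc1)).trans_lt hc2
  rwa [ENNReal.div_le_iff_le_mul (by simp [hr]) (by simp), mul_comm] at h2

theorem eventually_edist_le_chart {x₀ : X}
    {L : EuclideanSpace ℝ (Fin d) ≃L[ℝ] EuclideanSpace ℝ (Fin d)} {r : ℝ≥0}
    (hL : ∀ᶠ u in 𝓝 (chartAt (EuclideanSpace ℝ (Fin d)) x₀ x₀), ∀ v : EuclideanSpace ℝ (Fin d),
        ‖mfderiv (𝓡 d) (𝓡 d) (chartAt (EuclideanSpace ℝ (Fin d)) x₀).symm u v‖ₑ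
          ≤ r * ‖L v‖ₑ) :
    ∃ U ∈ 𝓝 x₀, ∀ x ∈ U, ∀ y ∈ U,
      edist x y ≤ r * edist (L (chartAt (EuclideanSpace ℝ (Fin d)) x₀ x))
        (L (chartAt (EuclideanSpace ℝ (Fin d)) x₀ y)) := by
  set φ := chartAt (EuclideanSpace ℝ (Fin d)) x₀ with hφ
  obtain ⟨ε, hε, hball⟩ := Metric.mem_nhds_iff.1 (inter_mem (chart_target_mem_nhds _ x₀) hL)
  refine ⟨φ.source ∩ φ ⁻¹' Metric.ball (φ x₀) ε, inter_mem (chart_source_mem_nhds _ x₀)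
    ((φ.continuousAt (mem_chart_source _ x₀)).preimage_mem_nhds (Metric.ball_mem_nhds _ hε)),
    fun x hx y hy ↦ ?_⟩
  have := riemannianEDist_chart_symm_le (L := L) (r := r) (convex_ball (φ x₀) ε)
    (fun z hz ↦ (hball hz).1) (fun z hz ↦ (hball hz).2) hx.2 hy.2
  rw [← hφ, φ.left_inv hx.1, φ.left_inv hy.1] at this
  rwa [IsRiemannianManifold.out (I := 𝓡 d) x y]

end Distance

/-! ### Gram matrices under a change of coordinates -/

section Gram

variable {d : ℕ} {X : Type*} [TopologicalSpace X] [ChartedSpace (EuclideanSpace ℝ (Fin d)) X]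
  [RiemannianBundle (fun x : X ↦ TangentSpace (𝓡 d) x)]

theorem inner_tangentSpace_congr {p q : X} (h : p = q) (v w : EuclideanSpace ℝ (Fin d)) :
    (inner ℝ (show TangentSpace (𝓡 d) p from v) (show TangentSpace (𝓡 d) p from w) : ℝ) =
      inner ℝ (show TangentSpace (𝓡 d) q from v) (show TangentSpace (𝓡 d) q from w) := by
  subst h
  rfl

theorem gramMatrix_congr {ι : Type*} (b : ι → EuclideanSpace ℝ (Fin d))
    {ψ ψ' : EuclideanSpace ℝ (Fin d) → X} {u : EuclideanSpace ℝ (Fin d)} (h : ψ =ᶠ[𝓝 u] ψ') :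
    gramMatrix b ψ u = gramMatrix b ψ' u := by
  ext i j
  have h1 : (mfderiv (𝓡 d) (𝓡 d) ψ u :
      EuclideanSpace ℝ (Fin d) →L[ℝ] EuclideanSpace ℝ (Fin d)) =
      mfderiv (𝓡 d) (𝓡 d) ψ' u := h.mfderiv_eq
  refine (inner_tangentSpace_congr h.eq_of_nhds _ _).trans ?_
  exact congrArg (fun A : EuclideanSpace ℝ (Fin d) →L[ℝ] EuclideanSpace ℝ (Fin d) ↦
    (inner ℝ (show TangentSpace (𝓡 d) (ψ' u) from A (b i))
      (show TangentSpace (𝓡 d) (ψ' u) from A (b j)) : ℝ)) h1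

/-- If G is the Gram matrix of the vectors A e_i, that of the vectors A J e_i is JᵀGJ. -/
theorem sum_inner_single {T : Type*} [NormedAddCommGroup T] [InnerProductSpace ℝ T]
    (A : EuclideanSpace ℝ (Fin d) →ₗ[ℝ] T)
    (J : EuclideanSpace ℝ (Fin d) →ₗ[ℝ] EuclideanSpace ℝ (Fin d)) :
    (Matrix.of fun i j : Fin d ↦ (inner ℝ (A (J (EuclideanSpace.single i (1 : ℝ))))
        (A (J (EuclideanSpace.single j (1 : ℝ)))) : ℝ)).det =
      J.det ^ 2 * (Matrix.of fun i j : Fin d ↦ (inner ℝ (A (EuclideanSpace.single i (1 : ℝ)))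
        (A (EuclideanSpace.single j (1 : ℝ))) : ℝ)).det := by
  set b := (EuclideanSpace.basisFun (Fin d) ℝ).toBasis with hb
  have hbi (i : Fin d) : EuclideanSpace.single i (1 : ℝ) = b i := by simp [hb]
  have hJ (i : Fin d) : J (b i) = ∑ k, (LinearMap.toMatrix b b J) k i • b k := by
    conv_lhs => rw [← b.sum_repr (J (b i))]
    simp [LinearMap.toMatrix_apply]
  have h1 : (Matrix.of fun i j : Fin d ↦ (inner ℝ (A (J (EuclideanSpace.single i (1 : ℝ))))
        (A (J (EuclideanSpace.single j (1 : ℝ)))) : ℝ)) =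
      (LinearMap.toMatrix b b J).transpose *
      (Matrix.of fun i j : Fin d ↦ (inner ℝ (A (EuclideanSpace.single i (1 : ℝ)))
        (A (EuclideanSpace.single j (1 : ℝ))) : ℝ)) * LinearMap.toMatrix b b J := by
    ext i j
    simp only [hbi, Matrix.of_apply, hJ, map_sum, map_smul, sum_inner, inner_sum, inner_smul_left,
      inner_smul_right, Matrix.mul_apply, Matrix.transpose_apply, Finset.sum_mul, Finset.mul_sum]
    refine Finset.sum_congr rfl fun k _ ↦ Finset.sum_congr rfl fun l _ ↦ ?_
    simp
    ring
  rw [h1, Matrix.det_mul, Matrix.det_mul, Matrix.det_transpose, LinearMap.det_toMatrix]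
  ring

theorem det_gramMatrix_comp {ψ : EuclideanSpace ℝ (Fin d) → X}
    {τ : EuclideanSpace ℝ (Fin d) → EuclideanSpace ℝ (Fin d)} {u : EuclideanSpace ℝ (Fin d)}
    (hτ : DifferentiableAt ℝ τ u) (hψ : MDifferentiableAt (𝓡 d) (𝓡 d) ψ (τ u)) :
    (gramMatrix (fun i ↦ EuclideanSpace.single i (1 : ℝ)) (ψ ∘ τ) u).det =
      (fderiv ℝ τ u).det ^ 2 *
        (gramMatrix (fun i ↦ EuclideanSpace.single i (1 : ℝ)) ψ (τ u)).det := by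
  have h1 : mfderiv (𝓡 d) (𝓡 d) (ψ ∘ τ) u = (mfderiv (𝓡 d) (𝓡 d) ψ (τ u)) ∘L
      (mfderiv (𝓡 d) (𝓡 d) τ u) := mfderiv_comp u hψ hτ.mdifferentiableAt
  have h2 := sum_inner_single (T := TangentSpace (𝓡 d) (ψ (τ u)))
    (mfderiv (𝓡 d) (𝓡 d) ψ (τ u)).toLinearMap (fderiv ℝ τ u).toLinearMap
  refine Eq.trans ?_ h2
  congr 1
  ext i j
  simp only [gramMatrix, Matrix.of_apply]
  rw [h1, mfderiv_eq_fderiv]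
  rfl

end Gram

/-! ### Gluing the chart volumes -/

section Volume

variable {d : ℕ} {X : Type*} [TopologicalSpace X] [ChartedSpace (EuclideanSpace ℝ (Fin d)) X]
  [RiemannianBundle (fun x : X ↦ TangentSpace (𝓡 d) x)] [MeasurableSpace X] [BorelSpace X]

theorem measurableSet_target_inter_symm_preimage {E : Type*} [TopologicalSpace E]
    [MeasurableSpace E] [BorelSpace E] (φ : OpenPartialHomeomorph X E)
    {A : Set X} (hA : MeasurableSet A) : MeasurableSet (φ.target ∩ φ.symm ⁻¹' A) := by
  have h4 : Measurable (φ.target.domRestrict φ.symm) :=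
    φ.continuousOn_symm.domRestrict.measurable
  have h5 := φ.open_target.measurableSet.subtype_image (h4 hA)
  convert h5 using 1
  ext u
  simp [Set.domRestrict, and_comm]

variable [IsManifold (𝓡 d) 1 X]

/-- The change of variables for the transition map produces the factor |det Dτ|, which is the square
root of the factor (det Dτ)² relating the two Gram determinants. -/
theorem chartVolume_eq_of_subset {x y : X} {A : Set X} (hA : MeasurableSet A)
    (hx : A ⊆ (chartAt (EuclideanSpace ℝ (Fin d)) x).source)
    (hy : A ⊆ (chartAt (EuclideanSpace ℝ (Fin d)) y).source) :
    chartVolume d x A = chartVolume d y A := by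
  set φ := chartAt (EuclideanSpace ℝ (Fin d)) x with hφ
  set φ' := chartAt (EuclideanSpace ℝ (Fin d)) y with hφ'
  set τ : EuclideanSpace ℝ (Fin d) → EuclideanSpace ℝ (Fin d) := φ' ∘ φ.symm with hτ
  set S := φ.target ∩ φ.symm ⁻¹' A with hS
  have himg : φ'.target ∩ φ'.symm ⁻¹' A = τ '' S := by
    ext v
    constructor
    · rintro ⟨hv, hvA⟩
      refine ⟨φ (φ'.symm v), ⟨φ.map_source (hx hvA), ?_⟩, ?_⟩
      · simpa [φ.left_inv (hx hvA)] using hvA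
      · simp [hτ, φ.left_inv (hx hvA), φ'.right_inv hv]
    · rintro ⟨u, ⟨hu, huA⟩, rfl⟩
      refine ⟨φ'.map_source (hy huA), ?_⟩
      simpa [hτ, φ'.left_inv (hy huA)] using huA
  have hopen : IsOpen (φ.target ∩ φ.symm ⁻¹' φ'.source) :=
    φ.isOpen_inter_preimage_symm φ'.open_source
  have hsub : S ⊆ φ.target ∩ φ.symm ⁻¹' φ'.source := fun u hu ↦ ⟨hu.1, hy hu.2⟩
  have hdiff : ∀ u ∈ S, DifferentiableAt ℝ τ u := by
    intro u hu
    have h1 : MDifferentiableAt (𝓡 d) (𝓡 d) φ.symm u :=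
      mdifferentiableAt_atlas_symm (chart_mem_atlas _ x) hu.1
    have h2 : MDifferentiableAt (𝓡 d) (𝓡 d) φ' (φ.symm u) :=
      mdifferentiableAt_atlas (chart_mem_atlas _ y) (hy hu.2)
    exact mdifferentiableAt_iff_differentiableAt.1 (h2.comp u h1)
  have hinj : InjOn τ S := by
    intro u hu v hv h
    exact φ.symm.injOn hu.1 hv.1 (φ'.injOn (hy hu.2) (hy hv.2) h)
  rw [chartVolume_apply d x hA, chartVolume_apply d y hA, ← hφ, ← hφ', himg, ← hS,
    lintegral_image_eq_lintegral_abs_det_fderiv_mul volume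
      (measurableSet_target_inter_symm_preimage φ hA)
      (fun u hu ↦ (hdiff u hu).hasFDerivAt.hasFDerivWithinAt) hinj]
  refine setLIntegral_congr_fun (measurableSet_target_inter_symm_preimage φ hA) fun u hu ↦ ?_
  have hev : φ.symm =ᶠ[𝓝 u] φ'.symm ∘ τ := by
    filter_upwards [hopen.mem_nhds (hsub hu)] with w hw
    simp [hτ, φ'.left_inv hw.2]
  have h1 : (metricMatrix d x u).det =
      (fderiv ℝ τ u).det ^ 2 * (metricMatrix d y (τ u)).det := by
    rw [metricMatrix, metricMatrix, ← hφ, ← hφ', gramMatrix_congr _ hev]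
    exact det_gramMatrix_comp (hdiff u hu)
      (mdifferentiableAt_atlas_symm (chart_mem_atlas _ y) (φ'.map_source (hy hu.2)))
  rw [h1, Real.sqrt_mul (sq_nonneg _), Real.sqrt_sq_eq_abs, ENNReal.ofReal_mul (abs_nonneg _)]

/-- On the domain of a chart, the Riemannian volume is the volume of the chart. -/
theorem riemannianVolume_eq_chartVolume {x₀ : X} {A : Set X} (hA : MeasurableSet A)
    (hAs : A ⊆ (chartAt (EuclideanSpace ℝ (Fin d)) x₀).source) :
    riemannianVolume d X A = chartVolume d x₀ A := by
  set U := (chartAt (EuclideanSpace ℝ (Fin d)) x₀).source with hU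
  have hUm : MeasurableSet U := (chartAt (EuclideanSpace ℝ (Fin d)) x₀).open_source.measurableSet
  refine le_antisymm ?_ (le_iSup (fun x : X ↦ chartVolume d x) x₀ A)
  -- The supremum is bounded through an explicit upper bound for all chart volumes: the volume of
  -- this chart plus infinite mass off its domain. The second term vanishes on A.
  have hle : riemannianVolume d X ≤ chartVolume d x₀ + (⊤ : Measure X).restrict Uᶜ := by
    refine iSup_le fun x ↦ Measure.le_iff.2 fun B hB ↦ ?_
    set V := (chartAt (EuclideanSpace ℝ (Fin d)) x).source with hV
    have hVm : MeasurableSet V := (chartAt (EuclideanSpace ℝ (Fin d)) x).open_source.measurableSet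
    rw [← measure_inter_add_sdiff B hUm, Measure.add_apply, Measure.restrict_apply hB]
    refine add_le_add ?_ ?_
    · have h1 : chartVolume d x (B ∩ U) = chartVolume d x (B ∩ U ∩ V) := by
        rw [chartVolume_apply d x (hB.inter hUm), chartVolume_apply d x ((hB.inter hUm).inter hVm)]
        congr 2
        ext u
        constructor
        · rintro ⟨h, h'⟩
          exact ⟨h, h', (chartAt (EuclideanSpace ℝ (Fin d)) x).map_target h⟩
        · rintro ⟨h, h', -⟩
          exact ⟨h, h'⟩
      rw [h1, chartVolume_eq_of_subset (y := x₀) ((hB.inter hUm).inter hVm) inter_subset_right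
        (fun z hz ↦ hz.1.2)]
      exact measure_mono fun z hz ↦ hz.1.1
    · exact (le_top : chartVolume d x ≤ ⊤) (B \ U)
  refine (hle A).trans ?_
  rw [Measure.add_apply, Measure.restrict_apply hA,
    (disjoint_compl_right_iff_subset.2 hAs).inter_eq, measure_empty, add_zero]

end Volume

/-- Converts comparisons up to a factor r arbitrarily close to 1 into limits. -/
theorem tendsto_of_forall_eventually_le_mul {α : Type*} {l : Filter α} {a : α → ℝ} {b : ℝ}
    (hb : 0 ≤ b)
    (h : ∀ r : ℝ≥0, 1 < r → ∀ᶠ x in l, a x ≤ r * b ∧ b ≤ r * a x) : Tendsto a l (𝓝 b) := by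
  rw [Metric.tendsto_nhds]
  intro ε hε
  set δ := ε / (2 * (b + 1)) with hδ
  have hδ0 : 0 < δ := by positivity
  have hδb : δ * (b + 1) = ε / 2 := by rw [hδ]; field_simp
  have hr : (1 : ℝ≥0) < 1 + δ.toNNReal := by simpa using hδ0
  filter_upwards [h _ hr] with x hx
  rw [NNReal.coe_add, NNReal.coe_one, Real.coe_toNNReal _ hδ0.le] at hx
  rw [Real.dist_eq, abs_lt]
  obtain ⟨h1, h2⟩ := hx
  constructor
  · by_contra hcon
    have : a x ≤ b - ε := by linarith
    nlinarith
  · nlinarith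

theorem norm_le_mul_norm_of_enorm_le {E F : Type*} [SeminormedAddGroup E] [SeminormedAddGroup F]
    {r : ℝ≥0} {a : E} {b : F} (h : ‖a‖ₑ ≤ r * ‖b‖ₑ) : ‖a‖ ≤ r * ‖b‖ := by
  rw [← ofReal_norm, ← ofReal_norm, ← ENNReal.ofReal_coe_nnreal,
    ← ENNReal.ofReal_mul r.coe_nonneg] at h
  exact (ENNReal.ofReal_le_ofReal_iff (by positivity)).1 h

/-! ### Charts almost preserve volume -/

section NormalizedVolume

variable {d : ℕ} {X : Type*} [TopologicalSpace X] [ChartedSpace (EuclideanSpace ℝ (Fin d)) X]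
  [RiemannianBundle (fun x : X ↦ TangentSpace (𝓡 d) x)] [IsManifold (𝓡 d) 1 X]

/-- If the inverse chart is, in the coordinates `L`, almost isometric at first order near `x₀`,
then the volume density of the chart converges to `|det L|` at `x₀`. -/
theorem tendsto_sqrt_det_metricMatrix {x₀ : X}
    {L : EuclideanSpace ℝ (Fin d) ≃L[ℝ] EuclideanSpace ℝ (Fin d)}
    (hL : ∀ r : ℝ≥0, 1 < r →
      (∀ᶠ y in 𝓝 x₀, ∀ w : TangentSpace (𝓡 d) y,
        ‖L (mfderiv (𝓡 d) (𝓡 d) (chartAt (EuclideanSpace ℝ (Fin d)) x₀) y w)‖ₑ ≤ r * ‖w‖ₑ) ∧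
      (∀ᶠ u in 𝓝 (chartAt (EuclideanSpace ℝ (Fin d)) x₀ x₀), ∀ v : EuclideanSpace ℝ (Fin d),
        ‖mfderiv (𝓡 d) (𝓡 d) (chartAt (EuclideanSpace ℝ (Fin d)) x₀).symm u v‖ₑ
          ≤ r * ‖L v‖ₑ)) :
    Tendsto (fun u ↦ √(metricMatrix d x₀ u).det)
      (𝓝 (chartAt (EuclideanSpace ℝ (Fin d)) x₀ x₀))
      (𝓝 |(L : EuclideanSpace ℝ (Fin d) →ₗ[ℝ] EuclideanSpace ℝ (Fin d)).det|) := by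
  set φ := chartAt (EuclideanSpace ℝ (Fin d)) x₀ with hφ
  have hx₀ : φ.symm (φ x₀) = x₀ := φ.left_inv (mem_chart_source _ x₀)
  have hc : Tendsto φ.symm (𝓝 (φ x₀)) (𝓝 x₀) := by
    have := φ.continuousAt_symm (mem_chart_target _ x₀)
    rwa [ContinuousAt, hx₀] at this
  have hnorm (v : EuclideanSpace ℝ (Fin d)) :
      Tendsto (fun u ↦ ‖mfderiv (𝓡 d) (𝓡 d) φ.symm u v‖) (𝓝 (φ x₀)) (𝓝 ‖L v‖) := by
    refine tendsto_of_forall_eventually_le_mul (norm_nonneg _) ?_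
    intro r hr
    filter_upwards [hc.eventually (hL r hr).1, (hL r hr).2, chart_target_mem_nhds _ x₀]
      with u h1 h2 hu
    -- The derivative of the chart inverts that of its inverse, so its upper bound is a lower bound
    -- for the inverse chart.
    have hinv : (mfderiv (𝓡 d) (𝓡 d) φ (φ.symm u)) (mfderiv (𝓡 d) (𝓡 d) φ.symm u v) = v := by
      have h3 : mfderiv (𝓡 d) (𝓡 d) (φ ∘ φ.symm) u =
          (mfderiv (𝓡 d) (𝓡 d) φ (φ.symm u)) ∘L (mfderiv (𝓡 d) (𝓡 d) φ.symm u) :=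
        mfderiv_comp u (mdifferentiableAt_atlas (chart_mem_atlas _ x₀) (φ.map_target hu))
          (mdifferentiableAt_atlas_symm (chart_mem_atlas _ x₀) hu)
      have h4 : (mfderiv (𝓡 d) (𝓡 d) (φ ∘ φ.symm) u :
          EuclideanSpace ℝ (Fin d) →L[ℝ] EuclideanSpace ℝ (Fin d)) =
          mfderiv (𝓡 d) (𝓡 d) (id : EuclideanSpace ℝ (Fin d) → EuclideanSpace ℝ (Fin d)) u := by
        apply Filter.EventuallyEq.mfderiv_eq
        filter_upwards [φ.open_target.mem_nhds hu] with w hw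
        exact φ.right_inv hw
      have h5 := congrArg (fun A : EuclideanSpace ℝ (Fin d) →L[ℝ] EuclideanSpace ℝ (Fin d) ↦ A v)
        (h3.symm.trans h4)
      refine h5.trans ?_
      rw [mfderiv_id]
      rfl
    have h1' := h1 (mfderiv (𝓡 d) (𝓡 d) φ.symm u v)
    have h1'' : ‖L v‖ₑ ≤ r * ‖mfderiv (𝓡 d) (𝓡 d) φ.symm u v‖ₑ :=
      (congrArg (fun z ↦ ‖L z‖ₑ) hinv).symm.trans_le h1'
    exact ⟨norm_le_mul_norm_of_enorm_le (h2 v), norm_le_mul_norm_of_enorm_le h1''⟩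
  -- Polarisation passes from norms to inner products. The Gram matrix therefore tends to LᵀL, of
  -- determinant (det L)².
  have hinner (v w : EuclideanSpace ℝ (Fin d)) :
      Tendsto (fun u ↦ (inner ℝ (mfderiv (𝓡 d) (𝓡 d) φ.symm u v)
        (mfderiv (𝓡 d) (𝓡 d) φ.symm u w) : ℝ)) (𝓝 (φ x₀)) (𝓝 (inner ℝ (L v) (L w))) := by
    have h1 := (((hnorm (v + w)).mul (hnorm (v + w))).sub
      ((hnorm v).mul (hnorm v))).sub ((hnorm w).mul (hnorm w))
    rw [real_inner_eq_norm_add_mul_self_sub_norm_mul_self_sub_norm_mul_self_div_two, ← map_add]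
    refine (h1.div_const 2).congr fun u ↦ ?_
    rw [real_inner_eq_norm_add_mul_self_sub_norm_mul_self_sub_norm_mul_self_div_two]
    have h2 : mfderiv (𝓡 d) (𝓡 d) φ.symm u (v + w) = mfderiv (𝓡 d) (𝓡 d) φ.symm u v +
      mfderiv (𝓡 d) (𝓡 d) φ.symm u w := map_add (mfderiv (𝓡 d) (𝓡 d) φ.symm u) v w
    rw [h2]
  have hdet : Tendsto (fun u ↦ (metricMatrix d x₀ u).det) (𝓝 (φ x₀))
      (𝓝 (Matrix.of fun i j : Fin d ↦ (inner ℝ (L (EuclideanSpace.single i (1 : ℝ)))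
        (L (EuclideanSpace.single j (1 : ℝ))) : ℝ)).det) := by
    have h1 : Tendsto (fun u ↦ metricMatrix d x₀ u) (𝓝 (φ x₀))
        (𝓝 (Matrix.of fun i j : Fin d ↦ (inner ℝ (L (EuclideanSpace.single i (1 : ℝ)))
        (L (EuclideanSpace.single j (1 : ℝ))) : ℝ))) :=
      tendsto_pi_nhds.2 fun i ↦ tendsto_pi_nhds.2 fun j ↦ hinner _ _
    exact ((continuous_id.matrix_det).tendsto _).comp h1
  have h3 := sum_inner_single (LinearMap.id : EuclideanSpace ℝ (Fin d) →ₗ[ℝ] _)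
    (L : EuclideanSpace ℝ (Fin d) →ₗ[ℝ] EuclideanSpace ℝ (Fin d))
  have h4 : (Matrix.of fun i j : Fin d ↦ (inner ℝ
      ((LinearMap.id : EuclideanSpace ℝ (Fin d) →ₗ[ℝ] _) (EuclideanSpace.single i (1 : ℝ)))
      ((LinearMap.id : EuclideanSpace ℝ (Fin d) →ₗ[ℝ] _) (EuclideanSpace.single j (1 : ℝ))) : ℝ))
      = 1 := by
    ext i j
    simp [Matrix.one_apply, EuclideanSpace.inner_single_left, PiLp.single_apply]
  rw [h4, Matrix.det_one, mul_one] at h3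
  rw [← Real.sqrt_sq_eq_abs, ← h3]
  exact (Real.continuous_sqrt.tendsto _).comp hdet

variable [MeasurableSpace X] [BorelSpace X]

/-- Near x₀ the volume density agrees up to a factor r with |det L|, which is the factor by which L
scales Lebesgue measure. -/
theorem exists_nhds_riemannianVolume_comparison {x₀ : X}
    {L : EuclideanSpace ℝ (Fin d) ≃L[ℝ] EuclideanSpace ℝ (Fin d)}
    (hL : Tendsto (fun u ↦ √(metricMatrix d x₀ u).det)
      (𝓝 (chartAt (EuclideanSpace ℝ (Fin d)) x₀ x₀))
      (𝓝 |(L : EuclideanSpace ℝ (Fin d) →ₗ[ℝ] EuclideanSpace ℝ (Fin d)).det|))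
    {r : ℝ≥0} (hr : 1 < r) :
    ∃ U ∈ 𝓝 x₀, ∀ A ⊆ U, MeasurableSet A →
      riemannianVolume d X A ≤
        r * volume ((fun x ↦ L (chartAt (EuclideanSpace ℝ (Fin d)) x₀ x)) '' A) ∧
      volume ((fun x ↦ L (chartAt (EuclideanSpace ℝ (Fin d)) x₀ x)) '' A) ≤
        r * riemannianVolume d X A := by
  set φ := chartAt (EuclideanSpace ℝ (Fin d)) x₀ with hφ
  set D := |(L : EuclideanSpace ℝ (Fin d) →ₗ[ℝ] EuclideanSpace ℝ (Fin d)).det| with hD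
  have hD0 : 0 < D := abs_pos.2 (LinearEquiv.isUnit_det' L.toLinearEquiv).ne_zero
  have hr' : (1 : ℝ) < r := by exact_mod_cast hr
  have hr0 : (0 : ℝ) < r := by linarith
  have hev : ∀ᶠ u in 𝓝 (φ x₀), √(metricMatrix d x₀ u).det ≤ r * D ∧
      D ≤ r * √(metricMatrix d x₀ u).det := by
    have h1 : D < r * D := by nlinarith
    have h2 : D / r < D := div_lt_self hD0 hr'
    filter_upwards [hL.eventually_lt_const h1, hL.eventually_const_lt h2] with u hu hu'
    refine ⟨hu.le, ?_⟩
    rw [div_lt_iff₀ hr0] at hu'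
    linarith
  refine ⟨φ.source ∩ φ ⁻¹' {u | √(metricMatrix d x₀ u).det ≤ r * D ∧
      D ≤ r * √(metricMatrix d x₀ u).det}, inter_mem (chart_source_mem_nhds _ x₀)
    ((φ.continuousAt (mem_chart_source _ x₀)).preimage_mem_nhds hev), fun A hA hAm ↦ ?_⟩
  have hAs : A ⊆ φ.source := fun z hz ↦ (hA hz).1
  set S := φ.target ∩ φ.symm ⁻¹' A with hS
  have hSm : MeasurableSet S := measurableSet_target_inter_symm_preimage φ hAm
  have hSA : S = φ '' A := by
    rw [hS]
    ext u
    constructor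
    · rintro ⟨h, h'⟩
      exact ⟨_, h', φ.right_inv h⟩
    · rintro ⟨x, hx, rfl⟩
      exact ⟨φ.map_source (hAs hx), by simpa [φ.left_inv (hAs hx)] using hx⟩
  have hvol : volume ((fun x ↦ L (φ x)) '' A) = ENNReal.ofReal D * volume S := by
    rw [hSA, hD]
    have : (fun x ↦ L (φ x)) '' A =
      (L : EuclideanSpace ℝ (Fin d) →ₗ[ℝ] EuclideanSpace ℝ (Fin d)) '' (φ '' A) := by
      rw [image_image]; rfl
    rw [this, Measure.addHaar_image_linearMap]
  rw [riemannianVolume_eq_chartVolume hAm hAs, chartVolume_apply d x₀ hAm, ← hφ, ← hS, hvol]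
  have hmem : ∀ u ∈ S, √(metricMatrix d x₀ u).det ≤ r * D ∧
      D ≤ r * √(metricMatrix d x₀ u).det := by
    intro u hu
    rw [hSA] at hu
    obtain ⟨x, hx, rfl⟩ := hu
    exact (hA hx).2
  rw [← setLIntegral_const, ← lintegral_const_mul' _ _ ENNReal.coe_ne_top,
    ← lintegral_const_mul' _ _ ENNReal.coe_ne_top]
  constructor
  · refine setLIntegral_mono' hSm fun u hu ↦ ?_
    rw [← ENNReal.ofReal_coe_nnreal, ← ENNReal.ofReal_mul r.coe_nonneg]
    exact ENNReal.ofReal_le_ofReal (hmem u hu).1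
  · refine setLIntegral_mono' hSm fun u hu ↦ ?_
    rw [← ENNReal.ofReal_coe_nnreal, ← ENNReal.ofReal_mul r.coe_nonneg]
    exact ENNReal.ofReal_le_ofReal (hmem u hu).2

end NormalizedVolume

/-- A measure `σ` on a metric space `X` is locally almost Euclidean of dimension `d` if every point
has neighbourhoods with coordinates in `ℝ^d` that distort distances and volumes by a factor as
close to `1` as desired. -/
def LocallyAlmostEuclidean (d : ℕ) {X : Type*} [EMetricSpace X] [MeasurableSpace X]
    (σ : Measure X) : Prop :=
  ∀ x₀ : X, ∀ r : ℝ≥0, 1 < r → ∃ ψ : OpenPartialHomeomorph X (EuclideanSpace ℝ (Fin d)),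
    x₀ ∈ ψ.source ∧ (∀ x ∈ ψ.source, ∀ y ∈ ψ.source, edist x y ≤ r * edist (ψ x) (ψ y)) ∧
    (∀ x ∈ ψ.source, ∀ y ∈ ψ.source, edist (ψ x) (ψ y) ≤ r * edist x y) ∧
    ∀ A ⊆ ψ.source, MeasurableSet A → σ A ≤ r * volume (ψ '' A) ∧ volume (ψ '' A) ≤ r * σ A

theorem locallyAlmostEuclidean_riemannianVolume {d : ℕ} {X : Type*} [EMetricSpace X]
    [MeasurableSpace X] [BorelSpace X] [ChartedSpace (EuclideanSpace ℝ (Fin d)) X]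
    [IsManifold (𝓡 d) 1 X] [RiemannianBundle (fun x : X ↦ TangentSpace (𝓡 d) x)]
    [IsContinuousRiemannianBundle (EuclideanSpace ℝ (Fin d)) (fun x : X ↦ TangentSpace (𝓡 d) x)]
    [IsRiemannianManifold (𝓡 d) X] :
    LocallyAlmostEuclidean d (riemannianVolume d X) := by
  intro x₀ r hr
  obtain ⟨L, hL⟩ := exists_chart_normalization (d := d) x₀
  obtain ⟨U₁, hU₁, h₁⟩ := eventually_edist_le_chart (hL r hr).2
  obtain ⟨U₂, hU₂, h₂⟩ := eventually_edist_chart_le (hL r hr).1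
  obtain ⟨U₃, hU₃, h₃⟩ := exists_nhds_riemannianVolume_comparison
    (tendsto_sqrt_det_metricMatrix hL) hr
  obtain ⟨U, hU, hUo, hxU⟩ := mem_nhds_iff.1 (inter_mem hU₁ (inter_mem hU₂ hU₃))
  refine ⟨((chartAt (EuclideanSpace ℝ (Fin d)) x₀).trans
    L.toHomeomorph.toOpenPartialHomeomorph).restrOpen U hUo, ?_, ?_, ?_, ?_⟩
  · simp [hxU]
  · intro x hx y hy
    exact h₁ x (hU hx.2).1 y (hU hy.2).1
  · intro x hx y hy
    exact h₂ x (hU hx.2).2.1 y (hU hy.2).2.1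
  · intro A hA hAm
    exact h₃ A (fun z hz ↦ (hU (hA hz).2).2.2) hAm

/-! ### From distribution functions to vague convergence -/

section Vague

/-- A compactly supported function on `[0, ∞)` is uniformly close to step functions. -/
theorem exists_step_approximation (h : C_c(ℝ≥0, ℝ≥0)) :
    ∃ R : ℝ≥0, 0 < R ∧ (∀ x, R < x → h x = 0) ∧ ∀ η : ℝ, 0 < η →
      ∃ n : ℕ, ∃ r : ℕ → ℝ≥0, ∃ c : ℕ → ℝ, (∀ j, 0 < r j) ∧
      ∀ x, |(h x : ℝ) - ∑ j ∈ Finset.range n, (Iic (r j)).indicator (fun _ ↦ c j) x| ≤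
        (Iic R).indicator (fun _ ↦ η) x := by
  obtain ⟨R₀, hR₀⟩ : ∃ R₀ : ℝ≥0, ∀ x, R₀ < x → h x = 0 := by
    obtain ⟨R₀, hR₀⟩ := h.hasCompactSupport.isCompact.bddAbove
    refine ⟨R₀, fun x hx ↦ ?_⟩
    by_contra hne
    exact absurd (hR₀ (subset_tsupport _ hne)) (not_le.2 hx)
  set R := R₀ + 1 with hR
  have hRpos : 0 < R := by positivity
  refine ⟨R, hRpos, fun x hx ↦ hR₀ x (lt_of_le_of_lt (by simp [hR]) hx), fun η hη ↦ ?_⟩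
  have huc : UniformContinuous h :=
    h.hasCompactSupport.uniformContinuous_of_continuous h.continuous
  obtain ⟨δ, hδ, hδh⟩ := Metric.uniformContinuous_iff.1 huc η hη
  obtain ⟨n, hn⟩ := exists_nat_gt ((R : ℝ) / δ)
  have hn0 : 0 < n := by
    have : (0 : ℝ) < n := lt_of_le_of_lt (by positivity) hn
    exact_mod_cast this
  have hn0' : (0 : ℝ≥0) < n := by exact_mod_cast hn0
  set a : ℝ≥0 := R / n with ha
  have hapos : 0 < a := by positivity
  have haδ : (a : ℝ) < δ := by
    rw [ha, NNReal.coe_div, NNReal.coe_natCast, div_lt_iff₀ (by positivity)]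
    rwa [div_lt_iff₀ hδ, mul_comm] at hn
  have hna : (n : ℝ≥0) * a = R := by rw [ha]; field_simp
  -- The steps end at (j + 1)a, not ja, so that all radii are positive: distribution functions are
  -- only assumed to converge at positive radii.
  let r : ℕ → ℝ≥0 := fun j ↦ (j + 1) * a
  have hrn : h (r n) = 0 := by
    apply hR₀
    have : r n = R + a := by simp only [r]; rw [add_mul, hna, one_mul]
    rw [this, hR]
    calc R₀ < R₀ + (1 + a) := by simp
      _ = R₀ + 1 + a := by ring
  refine ⟨n, r, fun j ↦ (h (r j) : ℝ) - h (r (j + 1)), fun j ↦ by positivity, fun x ↦ ?_⟩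
  -- The first step that contains x, with truncated subtraction giving 0 at x = 0. The increments
  -- from m on telescope to h (r m), and r m is within a of x.
  set m : ℕ := ⌈x / a⌉₊ - 1 with hm
  have hxr (j : ℕ) : x ≤ r j ↔ m ≤ j := by
    rw [hm, Nat.sub_le_iff_le_add, Nat.ceil_le, div_le_iff₀ hapos]
    simp [r]
  have hsum : ∑ j ∈ Finset.range n,
      (Iic (r j)).indicator (fun _ ↦ (h (r j) : ℝ) - h (r (j + 1))) x =
      ∑ j ∈ Finset.Ico m n, ((h (r j) : ℝ) - h (r (j + 1))) := by
    simp only [indicator_apply, mem_Iic, hxr]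
    rw [← Finset.sum_filter]
    congr 1
    ext j
    simp [and_comm]
  rw [hsum]
  by_cases hxR : x ≤ R
  · have hmn : m ≤ n := by
      rw [← hxr]
      refine hxR.trans ?_
      rw [← hna]
      exact mul_le_mul_of_nonneg_right (by simp) zero_le
    have htel : ∑ j ∈ Finset.Ico m n, ((h (r j) : ℝ) - h (r (j + 1))) = h (r m) := by
      have := Finset.sum_Ico_sub (fun j ↦ -(h (r j) : ℝ)) hmn
      simp only [neg_sub_neg, hrn] at this
      rw [this]
      simp
    rw [htel, indicator_of_mem (show x ∈ Iic R from hxR)]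
    have h1 : x ≤ r m := (hxr m).2 le_rfl
    have h2 : r m ≤ x + a := by
      by_cases hm0 : m = 0
      · simp [r, hm0]
      · have h3 : ¬ x ≤ r (m - 1) := by rw [hxr]; omega
        have h4 : r m = r (m - 1) + a := by
          obtain ⟨k, hk⟩ := Nat.exists_eq_succ_of_ne_zero hm0
          rw [hk]
          simp only [r, Nat.succ_eq_add_one, Nat.add_sub_cancel]
          push_cast
          ring
        rw [h4]
        gcongr
        exact (not_le.1 h3).le
    have h5 : dist x (r m) < δ := by
      rw [NNReal.dist_eq, abs_sub_comm, abs_of_nonneg (by simpa using h1)]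
      have : (r m : ℝ) ≤ x + a := by exact_mod_cast h2
      linarith
    have h6 := (hδh h5).le
    rwa [NNReal.dist_eq] at h6
  · have hnm : n ≤ m := by
      by_contra hcon
      have h1 : m ≤ n - 1 := by omega
      rw [← hxr] at h1
      apply hxR
      refine h1.trans ?_
      rw [← hna]
      obtain ⟨k, hk⟩ := Nat.exists_eq_succ_of_ne_zero hn0.ne'
      simp [r, hk]
    have h0 : h x = 0 := hR₀ x (lt_of_le_of_lt (by simp [hR]) (not_le.1 hxR))
    rw [Finset.Ico_eq_empty_of_le hnm, h0, indicator_of_notMem (by simpa using hxR)]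
    simp

theorem integrable_of_compactlySupported {μ : Measure ℝ≥0}
    (hμ : ∀ R, μ (Iic R) ≠ ⊤) (h : C_c(ℝ≥0, ℝ≥0)) :
    Integrable (fun x ↦ (h x : ℝ)) μ := by
  obtain ⟨R, -, hR, -⟩ := exists_step_approximation h
  have : IsFiniteMeasure (μ.restrict (Iic R)) := ⟨by simpa using (hμ R).lt_top⟩
  have hc : Continuous fun x ↦ (h x : ℝ) := NNReal.continuous_coe.comp h.continuous
  have hcs : HasCompactSupport fun x ↦ (h x : ℝ) := h.hasCompactSupport.comp_left NNReal.coe_zero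
  obtain ⟨C, hC⟩ := hcs.exists_bound_of_continuous hc
  have h1 : IntegrableOn (fun x ↦ (h x : ℝ)) (Iic R) μ :=
    Integrable.of_bound hc.aestronglyMeasurable C (Eventually.of_forall hC)
  refine h1.integrable_of_forall_notMem_eq_zero fun x hx ↦ ?_
  rw [hR x (by simpa using hx), NNReal.coe_zero]

theorem abs_integral_sub_step_le {μ : Measure ℝ≥0} (hμ : ∀ R, μ (Iic R) ≠ ⊤)
    (h : C_c(ℝ≥0, ℝ≥0)) {η : ℝ} {R : ℝ≥0} {n : ℕ} {r : ℕ → ℝ≥0} {c : ℕ → ℝ}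
    (hstep : ∀ x, |(h x : ℝ) - ∑ j ∈ Finset.range n, (Iic (r j)).indicator (fun _ ↦ c j) x| ≤
        (Iic R).indicator (fun _ ↦ η) x) :
    |∫ x, (h x : ℝ) ∂μ - ∑ j ∈ Finset.range n, c j * μ.real (Iic (r j))| ≤ η * μ.real (Iic R) := by
  have hint (R : ℝ≥0) (c : ℝ) : Integrable ((Iic R).indicator (fun _ ↦ c)) μ :=
    (integrable_indicator_iff measurableSet_Iic).2 (integrableOn_const (hμ R))
  have h1 : ∑ j ∈ Finset.range n, c j * μ.real (Iic (r j)) =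
      ∫ x, ∑ j ∈ Finset.range n, (Iic (r j)).indicator (fun _ ↦ c j) x ∂μ := by
    rw [integral_finsetSum _ fun j _ ↦ hint _ _]
    refine Finset.sum_congr rfl fun j _ ↦ ?_
    rw [integral_indicator_const _ measurableSet_Iic, smul_eq_mul, mul_comm]
  have h2 : η * μ.real (Iic R) = ∫ x, (Iic R).indicator (fun _ ↦ η) x ∂μ := by
    rw [integral_indicator_const _ measurableSet_Iic, smul_eq_mul, mul_comm]
  rw [h1, h2, ← integral_sub (integrable_of_compactlySupported hμ h)
    (integrable_finsetSum _ fun j _ ↦ hint _ _)]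
  refine (abs_integral_le_integral_abs).trans (integral_mono ?_ (hint _ _) hstep)
  exact ((integrable_of_compactlySupported hμ h).sub
    (integrable_finsetSum _ fun j _ ↦ hint _ _)).abs

/-- Convergence of the distribution functions implies vague convergence. -/
theorem tendsto_lintegral_of_tendsto_Iic {ρ : ℕ → Measure ℝ≥0} {κ : Measure ℝ≥0}
    (hρ : ∀ i R, ρ i (Iic R) ≠ ⊤) (hκ : ∀ R, κ (Iic R) ≠ ⊤)
    (hlim : ∀ R, 0 < R → Tendsto (fun i ↦ (ρ i).real (Iic R)) atTop (𝓝 (κ.real (Iic R))))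
    (h : C_c(ℝ≥0, ℝ≥0)) :
    Tendsto (fun i ↦ ∫⁻ t, (h t : ℝ≥0∞) ∂(ρ i)) atTop (𝓝 (∫⁻ t, (h t : ℝ≥0∞) ∂κ)) := by
  have hreal : Tendsto (fun i ↦ ∫ t, (h t : ℝ) ∂(ρ i)) atTop (𝓝 (∫ t, (h t : ℝ) ∂κ)) := by
    obtain ⟨R, hR, -, hstep⟩ := exists_step_approximation h
    rw [Metric.tendsto_nhds]
    intro ε hε
    set K := κ.real (Iic R) + 1 with hK
    have hK0 : 0 < K := by positivity
    obtain ⟨n, r, c, hr, hx⟩ := hstep (ε / (3 * K)) (by positivity)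
    have hsum : Tendsto (fun i ↦ ∑ j ∈ Finset.range n, c j * (ρ i).real (Iic (r j))) atTop
        (𝓝 (∑ j ∈ Finset.range n, c j * κ.real (Iic (r j)))) :=
      tendsto_finsetSum _ fun j _ ↦ (hlim _ (hr j)).const_mul _
    filter_upwards [Metric.tendsto_nhds.1 hsum (ε / 3) (by positivity),
      (hlim R hR).eventually_lt_const (show κ.real (Iic R) < K by linarith)] with i h1 h2
    have h3 := abs_integral_sub_step_le (hρ i) h hx
    have h4 := abs_integral_sub_step_le hκ h hx
    have h5 : ε / (3 * K) * K = ε / 3 := by field_simp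
    have h6 : ε / (3 * K) * (ρ i).real (Iic R) ≤ ε / 3 := by
      rw [← h5]; gcongr
    have h7 : ε / (3 * K) * κ.real (Iic R) < ε / 3 := by
      rw [← h5]; gcongr; linarith
    rw [Real.dist_eq] at h1 ⊢
    rw [abs_lt] at h1 ⊢
    rw [abs_le] at h3 h4
    constructor <;> linarith [h1.1, h1.2, h3.1, h3.2, h4.1, h4.2]
  have hcoe (μ : Measure ℝ≥0) (hμ : ∀ R, μ (Iic R) ≠ ⊤) :
      ∫⁻ t, (h t : ℝ≥0∞) ∂μ = ENNReal.ofReal (∫ t, (h t : ℝ) ∂μ) := by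
    rw [ofReal_integral_eq_lintegral_ofReal (integrable_of_compactlySupported hμ h)
      (Eventually.of_forall fun x ↦ (h x).coe_nonneg)]
    simp
  simp_rw [hcoe _ (hρ _), hcoe _ hκ]
  exact ENNReal.tendsto_ofReal hreal

end Vague

/-! ### Volumes of small balls and mass near the diagonal -/

section BallVolume

variable {d : ℕ} {X : Type*} [EMetricSpace X] [MeasurableSpace X] [BorelSpace X] {σ : Measure X}

theorem measurableSet_edist_le (x : X) (t : ℝ≥0∞) : MeasurableSet {y | edist x y ≤ t} :=
  (isClosed_le (continuous_const.edist continuous_id) continuous_const).measurableSet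

theorem volume_closedBall_euclidean (z : EuclideanSpace ℝ (Fin d)) (t : ℝ≥0) :
    volume (Metric.closedBall z (t : ℝ)) =
      (t : ℝ≥0∞) ^ d * volume (Metric.ball (0 : EuclideanSpace ℝ (Fin d)) 1) := by
  rw [Measure.addHaar_closedBall _ _ t.coe_nonneg, finrank_euclideanSpace, Fintype.card_fin,
    ENNReal.ofReal_pow t.coe_nonneg, ENNReal.ofReal_coe_nnreal]

/-- In the coordinates, the ball of radius t lies between Euclidean balls of radii t/r and rt. This
costs r^d, and the comparison of volumes costs one more r. -/
theorem LocallyAlmostEuclidean.eventually_nhds_ball (hσ : LocallyAlmostEuclidean d σ) (x₀ : X)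
    {r : ℝ≥0} (hr : 1 < r) :
    ∃ η : ℝ≥0, 0 < η ∧ ∀ᶠ x in 𝓝 x₀, ∀ t : ℝ≥0, t < η →
      σ {y | edist x y ≤ t} ≤
        r ^ (d + 1) * (t ^ d * volume (Metric.ball (0 : EuclideanSpace ℝ (Fin d)) 1)) ∧
      t ^ d * volume (Metric.ball (0 : EuclideanSpace ℝ (Fin d)) 1) ≤
        r ^ (d + 1) * σ {y | edist x y ≤ t} := by
  obtain ⟨ψ, hx₀, h1, h2, h3⟩ := hσ x₀ r hr
  obtain ⟨η₁, hη₁, hb₁⟩ := EMetric.mem_nhds_iff.1 (ψ.open_source.mem_nhds hx₀)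
  obtain ⟨η₂, hη₂, hb₂⟩ := EMetric.mem_nhds_iff.1 (ψ.open_target.mem_nhds (ψ.map_source hx₀))
  -- Half the smaller radius: a point within η of another that is itself within η of the centre
  -- stays in the chart domain, and likewise in the target.
  obtain ⟨η, hη, hηlt⟩ := ENNReal.lt_iff_exists_nnreal_btwn.1
    (ENNReal.half_pos (lt_min hη₁ hη₂).ne')
  have hη0 : 0 < η := by exact_mod_cast hη
  have hsum : (η : ℝ≥0∞) + η ≤ min η₁ η₂ := by
    calc (η : ℝ≥0∞) + η ≤ min η₁ η₂ / 2 + min η₁ η₂ / 2 := add_le_add hηlt.le hηlt.le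
      _ = min η₁ η₂ := ENNReal.add_halves _
  have hr0 : r ≠ 0 := (zero_lt_one.trans hr).ne'
  refine ⟨η, hη0, ?_⟩
  filter_upwards [Metric.eball_mem_nhds x₀ hη, ψ.open_source.mem_nhds hx₀,
    (ψ.continuousAt hx₀).preimage_mem_nhds (Metric.eball_mem_nhds _ hη)] with x hx hxs hψx t ht
  rw [Metric.mem_eball] at hx
  rw [mem_preimage, Metric.mem_eball] at hψx
  have ht' : (t : ℝ≥0∞) < η := by exact_mod_cast ht
  set B := {y | edist x y ≤ t} with hB
  have hBs : B ⊆ ψ.source := fun y hy ↦ hb₁ <| by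
    rw [Metric.mem_eball, edist_comm]
    calc edist x₀ y ≤ edist x x₀ + edist x y := edist_triangle_left _ _ _
      _ < η + η := ENNReal.add_lt_add hx (lt_of_le_of_lt hy ht')
      _ ≤ η₁ := hsum.trans (min_le_left _ _)
  obtain ⟨h4, h5⟩ := h3 B hBs (measurableSet_edist_le x t)
  constructor
  · have h6 : ψ '' B ⊆ Metric.closedBall (ψ x) ((r * t : ℝ≥0) : ℝ) := by
      rintro _ ⟨y, hy, rfl⟩
      rw [← Metric.closedEBall_coe, Metric.mem_closedEBall, edist_comm, ENNReal.coe_mul]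
      exact (h2 x hxs y (hBs hy)).trans (by gcongr; exact hy)
    calc σ B ≤ r * volume (ψ '' B) := h4
      _ ≤ r * ((r * t : ℝ≥0) ^ d * volume (Metric.ball (0 : EuclideanSpace ℝ (Fin d)) 1)) := by
        rw [← volume_closedBall_euclidean (ψ x)]
        gcongr
      _ = _ := by rw [ENNReal.coe_mul, mul_pow]; ring
  · have h6 : Metric.closedBall (ψ x) ((t / r : ℝ≥0) : ℝ) ⊆ ψ '' B := by
      intro z hz
      rw [← Metric.closedEBall_coe, Metric.mem_closedEBall] at hz
      have htr : (t / r : ℝ≥0) ≤ t := div_le_self zero_le hr.le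
      have hzt : z ∈ ψ.target := hb₂ <| by
        rw [Metric.mem_eball]
        calc edist z (ψ x₀) ≤ edist z (ψ x) + edist (ψ x) (ψ x₀) := edist_triangle _ _ _
          _ < η + η := ENNReal.add_lt_add (lt_of_le_of_lt (hz.trans (by exact_mod_cast htr)) ht')
            hψx
          _ ≤ η₂ := hsum.trans (min_le_right _ _)
      refine ⟨ψ.symm z, ?_, ψ.right_inv hzt⟩
      have h7 := h1 x hxs _ (ψ.map_target hzt)
      rw [ψ.right_inv hzt, edist_comm (ψ x)] at h7
      refine h7.trans ((mul_le_mul_right hz _).trans_eq ?_)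
      rw [← ENNReal.coe_mul, mul_div_cancel₀ _ hr0]
    have h8 := (measure_mono h6).trans h5
    rw [volume_closedBall_euclidean] at h8
    calc t ^ d * volume (Metric.ball (0 : EuclideanSpace ℝ (Fin d)) 1)
        = r ^ d * ((t / r : ℝ≥0) ^ d *
          volume (Metric.ball (0 : EuclideanSpace ℝ (Fin d)) 1)) := by
          rw [← mul_assoc, ← mul_pow, ← ENNReal.coe_mul, mul_div_cancel₀ _ hr0]
      _ ≤ r ^ d * (r * σ B) := by gcongr
      _ = _ := by ring

theorem measurableSet_pair_edist_le [SecondCountableTopology X] (t : ℝ≥0∞) :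
    MeasurableSet {p : X × X | edist p.1 p.2 ≤ t} :=
  (isClosed_le continuous_edist continuous_const).measurableSet

/-- The mass that `σ × σ` gives to the pairs of points at distance at most `t`. -/
noncomputable def pairMass (σ : Measure X) (t : ℝ≥0) : ℝ := (σ.prod σ).real {p | edist p.1 p.2 ≤ t}

theorem tendsto_pairMass [CompactSpace X] [IsProbabilityMeasure σ]
    (hσ : LocallyAlmostEuclidean d σ) :
    Tendsto (fun t : ℝ≥0 ↦ pairMass σ t / t ^ d) (𝓝[>] 0)
      (𝓝 (volume.real (Metric.ball (0 : EuclideanSpace ℝ (Fin d)) 1))) := by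
  refine tendsto_of_forall_eventually_le_mul measureReal_nonneg fun c hc ↦ ?_
  obtain ⟨r, hr, hrc⟩ : ∃ r : ℝ≥0, 1 < r ∧ r ^ (d + 1) ≤ c := by
    have h1 : Tendsto (fun r : ℝ≥0 ↦ r ^ (d + 1)) (𝓝[>] 1) (𝓝 1) := by
      have := ((continuous_pow (d + 1)).tendsto (1 : ℝ≥0))
      rw [one_pow] at this
      exact this.mono_left nhdsWithin_le_nhds
    obtain ⟨r, hr1, hr2⟩ := ((h1.eventually_lt_const hc).and self_mem_nhdsWithin).exists
    exact ⟨r, hr2, hr1.le⟩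
  choose η hη hball using fun x₀ : X ↦ hσ.eventually_nhds_ball x₀ hr
  -- The threshold for t depends on the point; compactness makes the bounds uniform, so that they
  -- can be integrated over x.
  have hunif : ∀ᶠ t : ℝ≥0 in 𝓝 0, ∀ x ∈ (univ : Set X),
      σ {y | edist x y ≤ t} ≤
        r ^ (d + 1) * (t ^ d * volume (Metric.ball (0 : EuclideanSpace ℝ (Fin d)) 1)) ∧
      t ^ d * volume (Metric.ball (0 : EuclideanSpace ℝ (Fin d)) 1) ≤
        r ^ (d + 1) * σ {y | edist x y ≤ t} := by
    refine isCompact_univ.eventually_forall_of_forall_eventually fun x _ ↦ ?_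
    have h1 : ∀ᶠ t : ℝ≥0 in 𝓝 0, t < η x := gt_mem_nhds (hη x)
    rw [nhds_prod_eq]
    filter_upwards [h1.prod_mk (hball x)] with p hp
    exact hp.2 p.1 hp.1
  filter_upwards [nhdsWithin_le_nhds hunif, self_mem_nhdsWithin] with t ht ht0
  set V := volume (Metric.ball (0 : EuclideanSpace ℝ (Fin d)) 1) with hV
  have hVtop : V ≠ ⊤ := measure_ball_lt_top.ne
  have hprod : (σ.prod σ) {p | edist p.1 p.2 ≤ t} = ∫⁻ x, σ {y | edist x y ≤ t} ∂σ :=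
    Measure.prod_apply (measurableSet_pair_edist_le t)
  have hle : (σ.prod σ) {p | edist p.1 p.2 ≤ t} ≤ r ^ (d + 1) * (t ^ d * V) := by
    rw [hprod]
    refine (lintegral_mono fun x ↦ (ht x (mem_univ x)).1).trans ?_
    simp
  have hge : t ^ d * V ≤ r ^ (d + 1) * (σ.prod σ) {p | edist p.1 p.2 ≤ t} := by
    rw [hprod, ← lintegral_const_mul' _ _ (by finiteness)]
    calc (t : ℝ≥0∞) ^ d * V = ∫⁻ x, t ^ d * V ∂σ := by simp
      _ ≤ _ := lintegral_mono fun x ↦ (ht x (mem_univ x)).2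
  have hle' := ENNReal.toReal_mono (by finiteness) hle
  have hge' := ENNReal.toReal_mono (by finiteness) hge
  simp only [ENNReal.toReal_mul, ENNReal.toReal_pow, ENNReal.coe_toReal] at hle' hge'
  have htd : (0 : ℝ) < (t : ℝ) ^ d := pow_pos (by exact_mod_cast ht0) _
  have hrc' : (r : ℝ) ^ (d + 1) ≤ c := by exact_mod_cast hrc
  change (t : ℝ) ^ d * volume.real (Metric.ball (0 : EuclideanSpace ℝ (Fin d)) 1) ≤
    r ^ (d + 1) * pairMass σ t at hge'
  change pairMass σ t ≤ r ^ (d + 1) *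
    (t ^ d * volume.real (Metric.ball (0 : EuclideanSpace ℝ (Fin d)) 1)) at hle'
  have hpm : 0 ≤ pairMass σ t := measureReal_nonneg
  constructor
  · rw [div_le_iff₀ htd]
    refine hle'.trans ?_
    rw [mul_comm (t ^ d : ℝ), ← mul_assoc]
    gcongr
  · rw [← mul_div_assoc, le_div_iff₀ htd, mul_comm]
    exact hge'.trans (by gcongr)

end BallVolume

/-! ### Row measures and their pair counts -/

section Empirical

variable {X : Type*} [EMetricSpace X] [MeasurableSpace X] [BorelSpace X]

/-- The uniform probability measure on the `i`-th row of the array. -/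
noncomputable def TriangularArray.empirical (ξ : TriangularArray X) (i : ℕ) : Measure X :=
  (ξ.N i : ℝ≥0)⁻¹ • ∑ j, Measure.dirac (ξ.pt i j)

theorem TriangularArray.N_pos_real (ξ : TriangularArray X) (i : ℕ) : (0 : ℝ) < ξ.N i := by
  exact_mod_cast ξ.N_pos i

theorem TriangularArray.empirical_real (ξ : TriangularArray X) (i : ℕ) {S : Set X}
    (hS : MeasurableSet S) :
    (ξ.empirical i).real S = (ξ.N i : ℝ)⁻¹ * ∑ j, S.indicator (fun _ ↦ (1 : ℝ)) (ξ.pt i j) := by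
  rw [empirical, measureReal_nnreal_smul_apply, measureReal_def, Measure.finsetSum_apply,
    ENNReal.toReal_sum (fun j _ ↦ measure_ne_top _ _)]
  simp only [NNReal.coe_inv, NNReal.coe_natCast]
  congr 1
  refine Finset.sum_congr rfl fun j _ ↦ ?_
  rw [Measure.dirac_apply' _ hS]
  by_cases h : ξ.pt i j ∈ S <;> simp [h]

instance (ξ : TriangularArray X) (i : ℕ) : IsProbabilityMeasure (ξ.empirical i) := by
  have : IsFiniteMeasure (ξ.empirical i) := by
    rw [TriangularArray.empirical]; infer_instance
  refine ⟨?_⟩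
  have h := ξ.empirical_real i MeasurableSet.univ
  simp only [indicator_univ, Finset.sum_const, Finset.card_univ, Fintype.card_fin, nsmul_eq_mul,
    mul_one, inv_mul_cancel₀ (ξ.N_pos_real i).ne'] at h
  rw [measureReal_def] at h
  rw [← ENNReal.ofReal_toReal (measure_ne_top (ξ.empirical i) univ), h, ENNReal.ofReal_one]

theorem TriangularArray.integral_empirical (ξ : TriangularArray X) (i : ℕ) {f : X → ℝ}
    (hf : Measurable f) :
    ∫ x, f x ∂(ξ.empirical i) = (1 / (ξ.N i : ℝ)) * ∑ j, f (ξ.pt i j) := by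
  rw [empirical, integral_smul_nnreal_measure, integral_finsetSum_measure]
  · simp [integral_dirac' _ _ hf.stronglyMeasurable, NNReal.smul_def]
  · intro j _
    exact integrable_dirac' hf.stronglyMeasurable (by simp)

theorem TriangularArray.Equidistributed.tendsto_empirical {ξ : TriangularArray X}
    {σ : Measure X} [IsProbabilityMeasure σ] (h : ξ.Equidistributed σ) :
    Tendsto (β := ProbabilityMeasure X) (fun i ↦ ⟨ξ.empirical i, inferInstance⟩) atTop
      (𝓝 ⟨σ, inferInstance⟩) := by
  refine ProbabilityMeasure.tendsto_iff_forall_integral_tendsto.2 fun f ↦ ?_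
  refine (h f).congr fun i ↦ ?_
  exact (ξ.integral_empirical i f.continuous.measurable).symm

open scoped Classical in
theorem TriangularArray.pairMass_empirical [SecondCountableTopology X] (ξ : TriangularArray X)
    (i : ℕ) (t : ℝ≥0) :
    pairMass (ξ.empirical i) t = (ξ.N i : ℝ)⁻¹ ^ 2 *
      (Finset.univ.filter fun p : Fin (ξ.N i) × Fin (ξ.N i) ↦
        edist (ξ.pt i p.1) (ξ.pt i p.2) ≤ t).card := by
  have h1 : pairMass (ξ.empirical i) t =
      ∫ x, (ξ.empirical i).real {y | edist x y ≤ t} ∂(ξ.empirical i) := by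
    rw [pairMass, measureReal_def, Measure.prod_apply (measurableSet_pair_edist_le t),
      ← integral_toReal (measurable_measure_prodMk_left
        (measurableSet_pair_edist_le t)).aemeasurable (Eventually.of_forall fun x ↦ by finiteness)]
    rfl
  have hm : Measurable fun x ↦ (ξ.empirical i).real {y | edist x y ≤ t} :=
    (measurable_measure_prodMk_left (measurableSet_pair_edist_le t)).ennreal_toReal
  rw [h1, ξ.integral_empirical i hm]
  simp_rw [ξ.empirical_real i (measurableSet_edist_le _ _)]
  rw [Finset.card_filter, Fintype.sum_prod_type, ← Finset.mul_sum]
  push_cast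
  rw [one_div, ← mul_assoc, sq]
  simp [indicator_apply]

open scoped Classical in
-- The mass of μ_i × μ_i includes the N diagonal pairs, each of weight s/N² after scaling; these are
-- the subtracted s/N.
theorem TriangularArray.pairCorrelation_Iic [SecondCountableTopology X] (ξ : TriangularArray X)
    {d : ℕ} {s : ℝ≥0} (hs : 0 < s) (i : ℕ) (R : ℝ≥0) :
    (ξ.pairCorrelation d s i).real (Iic R) =
      s * pairMass (ξ.empirical i) (R / s ^ (1 / (d : ℝ))) - s / ξ.N i := by
  have hs' : 0 < s ^ (1 / (d : ℝ)) := NNReal.rpow_pos hs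
  have hN := ξ.N_pos_real i
  set t := R / s ^ (1 / (d : ℝ)) with ht
  have hcard : ((Finset.univ.filter fun p : Fin (ξ.N i) × Fin (ξ.N i) ↦
        edist (ξ.pt i p.1) (ξ.pt i p.2) ≤ t).card : ℝ) =
      (Finset.univ.filter fun p : Fin (ξ.N i) × Fin (ξ.N i) ↦
        p.1 ≠ p.2 ∧ edist (ξ.pt i p.1) (ξ.pt i p.2) ≤ t).card + ξ.N i := by
    rw [← Finset.card_filter_add_card_filter_not (s := Finset.univ.filter
      fun p : Fin (ξ.N i) × Fin (ξ.N i) ↦ edist (ξ.pt i p.1) (ξ.pt i p.2) ≤ t)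
      (fun p ↦ p.1 ≠ p.2), Finset.filter_filter, Finset.filter_filter]
    have hdiag : (Finset.univ.filter fun p : Fin (ξ.N i) × Fin (ξ.N i) ↦
        edist (ξ.pt i p.1) (ξ.pt i p.2) ≤ t ∧ ¬ p.1 ≠ p.2) =
        Finset.univ.image fun j : Fin (ξ.N i) ↦ (j, j) := by
      ext ⟨j, k⟩
      simp only [Finset.mem_filter, Finset.mem_univ, true_and, not_not, Finset.mem_image,
        Prod.mk.injEq]
      constructor
      · rintro ⟨-, rfl⟩
        exact ⟨j, rfl, rfl⟩
      · rintro ⟨l, rfl, rfl⟩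
        simp
    rw [hdiag, Finset.card_image_of_injective _ (fun a b h ↦ (Prod.mk.inj h).1)]
    simp [and_comm]
  have hmain : (ξ.pairCorrelation d s i).real (Iic R) = (s / (ξ.N i : ℝ) ^ 2) *
      (Finset.univ.filter fun p : Fin (ξ.N i) × Fin (ξ.N i) ↦
        p.1 ≠ p.2 ∧ edist (ξ.pt i p.1) (ξ.pt i p.2) ≤ t).card := by
    rw [pairCorrelation, measureReal_nnreal_smul_apply, measureReal_def, Measure.finsetSum_apply,
      ENNReal.toReal_sum (fun j _ ↦ measure_ne_top _ _)]
    congr 1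
    rw [Finset.card_eq_sum_ones, Finset.sum_filter, Finset.sum_filter]
    push_cast
    refine Finset.sum_congr rfl fun p _ ↦ ?_
    rw [Measure.dirac_apply' _ measurableSet_Iic]
    have hiff : edist (ξ.pt i p.1) (ξ.pt i p.2) ≠ ⊤ →
        (s ^ (1 / (d : ℝ)) * (edist (ξ.pt i p.1) (ξ.pt i p.2)).toNNReal ≤ R ↔
        edist (ξ.pt i p.1) (ξ.pt i p.2) ≤ t) := by
      intro hne
      rw [← ENNReal.coe_toNNReal hne, ENNReal.coe_le_coe, ht, le_div_iff₀ hs', mul_comm]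
      simp
    by_cases h1 : p.1 = p.2
    · simp [h1]
    by_cases h2 : edist (ξ.pt i p.1) (ξ.pt i p.2) = ⊤
    · simp [h1, h2]
    · simp only [ne_eq, h1, not_false_eq_true, h2, and_self, true_and, if_true]
      by_cases h3 : edist (ξ.pt i p.1) (ξ.pt i p.2) ≤ t
      · rw [indicator_of_mem (show _ ∈ Iic R from (hiff h2).2 h3)]
        simp [h3]
      · rw [indicator_of_notMem (show _ ∉ Iic R from mt (hiff h2).1 h3)]
        simp [h3]
  rw [hmain, ξ.pairMass_empirical, hcard]
  field_simp
  ring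

end Empirical

/-! ### Quantitative convergence of the distance distribution -/

section Levy

variable {X : Type*} [EMetricSpace X] [MeasurableSpace X] [BorelSpace X]

/-- The distance of the two points of a pair, truncated at `1`. -/
noncomputable def truncDist (p : X × X) : ℝ := (min (edist p.1 p.2) 1).toReal

theorem continuous_truncDist : Continuous (truncDist : X × X → ℝ) :=
  ENNReal.continuousOn_toReal.comp_continuous (continuous_edist.min continuous_const)
    fun _ ↦ ((min_le_right _ _).trans_lt ENNReal.one_lt_top).ne

/-- Truncation makes the possibly infinite distance a continuous real function without changing its
sublevel sets below 1. -/
theorem truncDist_le_iff {t : ℝ≥0} (ht : t < 1) (p : X × X) :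
    truncDist p ≤ t ↔ edist p.1 p.2 ≤ t := by
  have hne : min (edist p.1 p.2) 1 ≠ ⊤ := ((min_le_right _ _).trans_lt ENNReal.one_lt_top).ne
  rw [truncDist, ← ENNReal.coe_toReal t, ENNReal.toReal_le_toReal hne ENNReal.coe_ne_top,
    min_le_iff]
  have : ¬ (1 : ℝ≥0∞) ≤ t := by simpa using ht
  simp [this]

theorem map_truncDist_Iic [SecondCountableTopology X] (μ : Measure X) {t : ℝ≥0} (ht : t < 1) :
    ((μ.prod μ).map truncDist).real (Iic (t : ℝ)) = pairMass μ t := by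
  rw [pairMass, measureReal_def, measureReal_def, Measure.map_apply continuous_truncDist.measurable
    measurableSet_Iic]
  congr 2
  ext p
  exact truncDist_le_iff ht p

theorem thickening_Iic_subset (a : ℝ) (ε : ℝ) : Metric.thickening ε (Iic a) ⊆ Iic (a + ε) := by
  intro x hx
  obtain ⟨y, hy, hxy⟩ := Metric.mem_thickening_iff.1 hx
  rw [Real.dist_eq, abs_lt] at hxy
  rw [mem_Iic] at hy ⊢
  linarith [hxy.2]

theorem measureReal_Iic_le_of_levyProkhorovEDist_lt {μ ν : Measure ℝ} [IsFiniteMeasure μ]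
    [IsFiniteMeasure ν] {ε : ℝ≥0} (h : levyProkhorovEDist μ ν < ε) (a : ℝ) :
    μ.real (Iic a) ≤ ν.real (Iic (a + ε)) + ε := by
  have h1 := (left_measure_le_of_levyProkhorovEDist_lt h (measurableSet_Iic (a := a))).trans
    (add_le_add (measure_mono (thickening_Iic_subset a _)) le_rfl)
  have h2 := ENNReal.toReal_mono (by finiteness) h1
  rwa [ENNReal.toReal_add (by finiteness) (by finiteness)] at h2

/-- If the empirical measures converge, then the pair masses converge in the Lévy distance. -/
theorem exists_levy_sequence [SecondCountableTopology X] {ξ : TriangularArray X} {σ : Measure X}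
    [IsProbabilityMeasure σ] (h : ξ.Equidistributed σ) :
    ∃ ε : ℕ → ℝ≥0, (∀ i : ℕ, 1 / ((i : ℝ≥0) + 1) ≤ ε i) ∧ Tendsto ε atTop (𝓝 0) ∧
      ∀ i (t : ℝ≥0), t + ε i < 1 → pairMass (ξ.empirical i) t ≤ pairMass σ (t + ε i) + ε i ∧
        (ε i ≤ t → pairMass σ (t - ε i) ≤ pairMass (ξ.empirical i) t + ε i) := by
  let P : ℕ → ProbabilityMeasure X := fun i ↦ ⟨ξ.empirical i, inferInstance⟩
  let Q : ProbabilityMeasure X := ⟨σ, inferInstance⟩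
  have h1 : Tendsto (fun i ↦ ((P i).prod (P i)).map continuous_truncDist.measurable.aemeasurable)
      atTop (𝓝 ((Q.prod Q).map continuous_truncDist.measurable.aemeasurable)) := by
    refine ProbabilityMeasure.tendsto_map_of_tendsto_of_continuous _ _ ?_ continuous_truncDist
    exact (ProbabilityMeasure.continuous_prod.tendsto (Q, Q)).comp
      (h.tendsto_empirical.prodMk_nhds h.tendsto_empirical)
  have h2 := (LevyProkhorov.probabilityMeasureHomeomorph (Ω := ℝ)).continuous.tendsto _ |>.comp h1
  have h3 : Tendsto (fun i ↦ levyProkhorovEDist (((ξ.empirical i).prod (ξ.empirical i)).map truncDist)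
      ((σ.prod σ).map truncDist)) atTop (𝓝 0) := by
    have := tendsto_iff_edist_tendsto_0.1 h2
    exact this
  set e := fun i ↦ levyProkhorovEDist (((ξ.empirical i).prod (ξ.empirical i)).map truncDist)
      ((σ.prod σ).map truncDist) with he
  have hfin (i : ℕ) : e i ≠ ⊤ := by
    have : IsProbabilityMeasure (((ξ.empirical i).prod (ξ.empirical i)).map truncDist) :=
      Measure.isProbabilityMeasure_map continuous_truncDist.measurable.aemeasurable
    have : IsProbabilityMeasure ((σ.prod σ).map truncDist) :=
      Measure.isProbabilityMeasure_map continuous_truncDist.measurable.aemeasurable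
    exact levyProkhorovEDist_ne_top _ _
  -- The summand 1/(i + 1) makes ε exceed the Lévy–Prokhorov distance strictly, and gives 1/ε_i ≤ i
  -- + 1 ≤ N_i, which later controls the diagonal.
  refine ⟨fun i ↦ (e i).toNNReal + 1 / ((i : ℝ≥0) + 1), fun i ↦ le_add_self, ?_, ?_⟩
  · have h4 := ((ENNReal.tendsto_toNNReal ENNReal.zero_ne_top).comp h3).add
      (tendsto_one_div_add_atTop_nhds_zero_nat (𝕜 := ℝ≥0))
    simpa using h4
  · intro i t ht
    set ε := (e i).toNNReal + 1 / ((i : ℝ≥0) + 1) with hε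
    have hlt : e i < ε := by
      rw [hε, ENNReal.coe_add, ENNReal.coe_toNNReal (hfin i)]
      exact ENNReal.lt_add_right (hfin i) (by simp)
    have : IsProbabilityMeasure (((ξ.empirical i).prod (ξ.empirical i)).map truncDist) :=
      Measure.isProbabilityMeasure_map continuous_truncDist.measurable.aemeasurable
    have : IsProbabilityMeasure ((σ.prod σ).map truncDist) :=
      Measure.isProbabilityMeasure_map continuous_truncDist.measurable.aemeasurable
    have ht1 : t < 1 := lt_of_le_of_lt le_self_add ht
    constructor
    · have := measureReal_Iic_le_of_levyProkhorovEDist_lt hlt t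
      rwa [map_truncDist_Iic _ ht1, ← NNReal.coe_add, map_truncDist_Iic _ ht] at this
    · intro hεt
      have := measureReal_Iic_le_of_levyProkhorovEDist_lt
        ((levyProkhorovEDist_comm _ _).trans_lt hlt) ((t - ε : ℝ≥0) : ℝ)
      rwa [map_truncDist_Iic _ (lt_of_le_of_lt tsub_le_self ht1), ← NNReal.coe_add,
        tsub_add_cancel_of_le hεt, map_truncDist_Iic _ ht1] at this

end Levy

/-- The tail infima of b are nondecreasing, positive and unbounded; the factors (i + 1)/(i + 2) make
them strictly increasing. -/
theorem exists_strictMono_le {b : ℕ → ℝ≥0} (hb : ∀ i, 0 < b i) (h : Tendsto b atTop atTop) :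
    ∃ s : ℕ → ℝ≥0, (∀ i, 0 < s i) ∧ StrictMono s ∧ Tendsto s atTop atTop ∧ ∀ i, s i ≤ b i := by
  set B : ℕ → ℝ≥0 := fun i ↦ ⨅ j, b (i + j) with hB
  have hBb (i j : ℕ) : B i ≤ b (i + j) := ciInf_le (OrderBot.bddBelow _) j
  have hBmono : Monotone B := by
    refine monotone_nat_of_le_succ fun i ↦ le_ciInf fun j ↦ ?_
    have := hBb i (1 + j)
    rwa [← add_assoc] at this
  have hB0 : 0 < B 0 := by
    obtain ⟨k, hk⟩ := Filter.Tendsto.exists_forall_le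
      (show Tendsto b cofinite atTop by rwa [Nat.cofinite_eq_atTop])
    exact (hb k).trans_le (le_ciInf fun j ↦ hk _)
  have hBpos (i : ℕ) : 0 < B i := hB0.trans_le (hBmono (Nat.zero_le i))
  have hfac (i : ℕ) : (i + 1 : ℝ≥0) / (i + 2) ≤ 1 := by
    rw [div_le_one (by positivity)]
    gcongr
    exact one_le_two
  refine ⟨fun i ↦ B i * ((i + 1) / (i + 2)), fun i ↦ mul_pos (hBpos i) (by positivity), ?_, ?_, ?_⟩
  · refine strictMono_nat_of_lt_succ fun i ↦ ?_
    have h1 : (i + 1 : ℝ≥0) / (i + 2) < ((i + 1 : ℕ) + 1 : ℝ≥0) / ((i + 1 : ℕ) + 2) := by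
      rw [div_lt_div_iff₀ (by positivity) (by positivity), ← NNReal.coe_lt_coe]
      push_cast
      nlinarith
    calc B i * ((i + 1) / (i + 2)) < B i * (((i + 1 : ℕ) + 1) / ((i + 1 : ℕ) + 2)) :=
          mul_lt_mul_of_pos_left h1 (hBpos i)
      _ ≤ B (i + 1) * (((i + 1 : ℕ) + 1) / ((i + 1 : ℕ) + 2)) := by
          gcongr
          exact hBmono (Nat.le_succ i)
  · rw [tendsto_atTop]
    intro K
    obtain ⟨I, hI⟩ := (h.eventually_ge_atTop (2 * K)).exists_forall_of_atTop
    filter_upwards [eventually_ge_atTop I] with i hi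
    have h1 : 2 * K ≤ B i := le_ciInf fun j ↦ hI _ (by omega)
    have h2 : (1 / 2 : ℝ≥0) ≤ (i + 1) / (i + 2) := by
      rw [div_le_div_iff₀ (by positivity) (by positivity), ← NNReal.coe_le_coe]
      push_cast
      nlinarith [(Nat.cast_nonneg i : (0 : ℝ) ≤ i)]
    calc K = 2 * K * (1 / 2) := by field_simp
      _ ≤ B i * ((i + 1) / (i + 2)) := mul_le_mul' h1 h2
  · intro i
    calc B i * ((i + 1) / (i + 2)) ≤ B i * 1 := by gcongr; exact hfac i
      _ ≤ b i := by simpa using hBb i 0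

theorem tendsto_nnreal_rpow_atTop {y : ℝ} (hy : 0 < y) :
    Tendsto (fun x : ℝ≥0 ↦ x ^ y) atTop atTop := by
  rw [← NNReal.tendsto_coe_atTop]
  exact ((tendsto_rpow_atTop hy).comp (NNReal.tendsto_coe_atTop.2 tendsto_id)).congr
    fun x ↦ by simp

/-! ### Equidistribution implies a Poisson limit -/

section PoissonLimit

variable {d : ℕ} {X : Type*} [EMetricSpace X] [CompactSpace X] [MeasurableSpace X] [BorelSpace X]
  {σ : Measure X} [IsProbabilityMeasure σ]

/-- Here s · pairMass(t) = (s^(1/d) t)^d · pairMass(t)/t^d, and t → 0 because s → ∞ while s^(1/d) t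
stays bounded. -/
theorem tendsto_mul_pairMass (hd : 0 < d) (hσ : LocallyAlmostEuclidean d σ) {s t : ℕ → ℝ≥0}
    {R : ℝ≥0} (hR : 0 < R) (hs : Tendsto s atTop atTop)
    (ht : Tendsto (fun i ↦ s i ^ (1 / (d : ℝ)) * t i) atTop (𝓝 R)) :
    Tendsto (fun i ↦ (s i : ℝ) * pairMass σ (t i)) atTop
      (𝓝 ((R : ℝ) ^ d * volume.real (Metric.ball (0 : EuclideanSpace ℝ (Fin d)) 1))) := by
  have hd' : (0 : ℝ) < 1 / d := by positivity
  have hs1 : Tendsto (fun i ↦ s i ^ (1 / (d : ℝ))) atTop atTop :=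
    (tendsto_nnreal_rpow_atTop hd').comp hs
  have hpos : ∀ᶠ i in atTop, 0 < s i ^ (1 / (d : ℝ)) ∧ 0 < t i := by
    filter_upwards [hs1.eventually_gt_atTop 0, ht.eventually_const_lt hR] with i h1 h2
    exact ⟨h1, pos_of_mul_pos_right h2 h1.le⟩
  have ht0 : Tendsto t atTop (𝓝[>] 0) := by
    refine tendsto_nhdsWithin_iff.2 ⟨?_, hpos.mono fun i hi ↦ hi.2⟩
    have h1 := ht.mul (tendsto_inv_atTop_zero.comp hs1)
    rw [mul_zero] at h1
    refine h1.congr' ?_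
    filter_upwards [hpos] with i hi
    rw [Function.comp_apply, mul_comm, ← mul_assoc, inv_mul_cancel₀ hi.1.ne', one_mul]
  have h2 := (((NNReal.tendsto_coe.2 ht).pow d).mul ((tendsto_pairMass hσ).comp ht0))
  refine h2.congr' ?_
  filter_upwards [hpos] with i hi
  have h3 : ((s i ^ (1 / (d : ℝ)) : ℝ≥0) : ℝ) ^ d = s i := by
    rw [← NNReal.coe_pow, ← NNReal.rpow_natCast, ← NNReal.rpow_mul,
      one_div_mul_cancel (by positivity), NNReal.rpow_one]
  have h4 : (t i : ℝ) ^ d ≠ 0 := pow_ne_zero _ (by exact_mod_cast hi.2.ne')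
  rw [NNReal.coe_mul, mul_pow, h3, Function.comp_apply]
  field_simp

theorem poissonMeasure_Iic_ne_top (d : ℕ) (R : ℝ≥0) : poissonMeasure d (Iic R) ≠ ⊤ := by
  have : (Iic R : Set ℝ≥0) = Icc 0 R := by ext; simp
  rw [this, poissonMeasure_Icc]
  have := (measure_ball_lt_top : volume (Metric.ball (0 : EuclideanSpace ℝ (Fin d)) 1) < ⊤).ne
  finiteness

theorem poissonMeasure_real_Iic (d : ℕ) (R : ℝ≥0) : (poissonMeasure d).real (Iic R) =
    (R : ℝ) ^ d * volume.real (Metric.ball (0 : EuclideanSpace ℝ (Fin d)) 1) := by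
  have : (Iic R : Set ℝ≥0) = Icc 0 R := by ext; simp
  rw [this, measureReal_def, poissonMeasure_Icc]
  simp [measureReal_def]

/-- An equidistributed array has a Poisson limit at every sufficiently slowly growing scale. -/
theorem TriangularArray.Equidistributed.exists_hasPoissonLimit (hd : 0 < d)
    (hσ : LocallyAlmostEuclidean d σ) {ξ : TriangularArray X} (h : ξ.Equidistributed σ) :
    ∃ s : ℕ → ℝ≥0, (∀ i, 0 < s i) ∧ StrictMono s ∧ Tendsto s atTop atTop ∧
      (∀ i, s i ≤ (ξ.N i : ℝ≥0)) ∧ HasPoissonLimit d (fun i ↦ ξ.pairCorrelation d (s i) i) := by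
  obtain ⟨ε, hεi, hε0, hε⟩ := exists_levy_sequence h
  have hεpos (i : ℕ) : 0 < ε i := lt_of_lt_of_le (by positivity) (hεi i)
  -- With s ≤ ε^(-1/2) and 1/ε ≤ N, both s ε and s/N are at most 1/s.
  have hb : Tendsto (fun i ↦ NNReal.sqrt (ε i)⁻¹) atTop atTop := by
    have h1 : Tendsto (fun i ↦ (ε i)⁻¹) atTop atTop :=
      tendsto_inv_nhdsGT_zero.comp (tendsto_nhdsWithin_iff.2 ⟨hε0, Eventually.of_forall hεpos⟩)
    rw [tendsto_atTop]
    intro K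
    filter_upwards [h1.eventually_ge_atTop (K ^ 2)] with i hi
    exact NNReal.le_sqrt_iff_sq_le.2 hi
  obtain ⟨s, hs0, hsm, hs, hsb⟩ := exists_strictMono_le
    (fun i ↦ NNReal.sqrt_pos.2 (inv_pos.2 (hεpos i))) hb
  have hs2 (i : ℕ) : s i ^ 2 ≤ (ε i)⁻¹ := NNReal.le_sqrt_iff_sq_le.1 (hsb i)
  have hN (i : ℕ) : (ε i)⁻¹ ≤ ξ.N i := by
    have h1 : i + 1 ≤ ξ.N i := by
      induction i with
      | zero => exact ξ.N_pos 0
      | succ k ih => exact Nat.succ_le_of_lt (lt_of_le_of_lt ih (ξ.N_strictMono k.lt_succ_self))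
    calc (ε i)⁻¹ ≤ (1 / ((i : ℝ≥0) + 1))⁻¹ := inv_anti₀ (by positivity) (hεi i)
      _ = ((i + 1 : ℕ) : ℝ≥0) := by simp
      _ ≤ ξ.N i := by exact_mod_cast h1
  have hsN (i : ℕ) : s i ^ 2 ≤ ξ.N i := (hs2 i).trans (hN i)
  have hNpos (i : ℕ) : (1 : ℝ≥0) ≤ ξ.N i := by exact_mod_cast ξ.N_pos i
  have hsinv : Tendsto (fun i ↦ (s i)⁻¹) atTop (𝓝 0) := tendsto_inv_atTop_zero.comp hs
  have hsε : Tendsto (fun i ↦ s i * ε i) atTop (𝓝 0) := by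
    refine tendsto_of_tendsto_of_tendsto_of_le_of_le tendsto_const_nhds hsinv
      (fun i ↦ zero_le) fun i ↦ ?_
    have := hs2 i
    rw [le_inv_comm₀ (pow_pos (hs0 i) 2) (hεpos i)] at this
    calc s i * ε i ≤ s i * (s i ^ 2)⁻¹ := by gcongr
      _ = (s i)⁻¹ := by have := (hs0 i).ne'; field_simp
  have hsNlim : Tendsto (fun i ↦ s i / ξ.N i) atTop (𝓝 0) := by
    refine tendsto_of_tendsto_of_tendsto_of_le_of_le tendsto_const_nhds hsinv
      (fun i ↦ zero_le) fun i ↦ ?_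
    calc s i / ξ.N i ≤ s i / s i ^ 2 := by gcongr; exact pow_pos (hs0 i) 2; exact hsN i
      _ = (s i)⁻¹ := by have := (hs0 i).ne'; field_simp
  refine ⟨s, hs0, hsm, hs, fun i ↦ ?_, ?_⟩
  · by_contra hcon
    have h1 := not_le.1 hcon
    have h2 : s i * 1 < s i * s i := mul_lt_mul_of_pos_left ((hNpos i).trans_lt h1) (hs0 i)
    have h3 := hsN i
    rw [sq] at h3
    exact absurd (h1.trans (by simpa using h2)) (not_lt.2 h3)
  refine tendsto_lintegral_of_tendsto_Iic (fun i R ↦ ?_) (poissonMeasure_Iic_ne_top d)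
    fun R hR ↦ ?_
  · have : IsFiniteMeasure (ξ.pairCorrelation d (s i) i) := by
      rw [TriangularArray.pairCorrelation]; infer_instance
    exact measure_ne_top _ _
  rw [poissonMeasure_real_Iic]
  simp_rw [ξ.pairCorrelation_Iic (hs0 _)]
  set q : ℕ → ℝ≥0 := fun i ↦ s i ^ (1 / (d : ℝ)) with hq
  have hqpos (i : ℕ) : 0 < q i := NNReal.rpow_pos (hs0 i)
  have hqε : Tendsto (fun i ↦ q i * ε i) atTop (𝓝 0) := by
    refine tendsto_of_tendsto_of_tendsto_of_le_of_le' tendsto_const_nhds hsε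
      (Eventually.of_forall fun i ↦ zero_le) ?_
    filter_upwards [hs.eventually_ge_atTop 1] with i hi
    have h1 : q i ≤ s i := by
      calc q i ≤ s i ^ (1 : ℝ) := NNReal.rpow_le_rpow_of_exponent_le hi
            ((div_le_one (by positivity)).2 (by exact_mod_cast hd))
        _ = s i := NNReal.rpow_one _
    gcongr
  have hq_top : Tendsto q atTop atTop :=
    (tendsto_nnreal_rpow_atTop (by positivity)).comp hs
  -- Shifting the radius R/q by ±ε does not change the rescaled limit R, so the upper and lower
  -- bounds have the same limit.
  have hup : Tendsto (fun i ↦ q i * (R / q i + ε i)) atTop (𝓝 R) := by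
    have h1 := (tendsto_const_nhds (x := R)).add hqε
    rw [add_zero] at h1
    refine h1.congr fun i ↦ ?_
    rw [mul_add, mul_div_cancel₀ _ (hqpos i).ne']
  have hlow : Tendsto (fun i ↦ q i * (R / q i - ε i)) atTop (𝓝 R) := by
    have h1 := (tendsto_const_nhds (x := R)).sub hqε
    rw [tsub_zero] at h1
    refine h1.congr fun i ↦ ?_
    rw [mul_tsub, mul_div_cancel₀ _ (hqpos i).ne']
  have h1 := tendsto_mul_pairMass hd hσ hR hs hup
  have h2 := tendsto_mul_pairMass hd hσ hR hs hlow
  have hsε' : Tendsto (fun i ↦ (s i : ℝ) * ε i) atTop (𝓝 0) := by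
    simpa using NNReal.tendsto_coe.2 hsε
  have hsN' : Tendsto (fun i ↦ (s i : ℝ) / ξ.N i) atTop (𝓝 0) := by
    simpa using NNReal.tendsto_coe.2 hsNlim
  have hu := (h1.add hsε').sub hsN'
  have hl := (h2.sub hsε').sub hsN'
  rw [add_zero, sub_zero] at hu
  rw [sub_zero, sub_zero] at hl
  have hsmall : ∀ᶠ i in atTop, R / q i + ε i < 1 := by
    have h3 : Tendsto (fun i ↦ R / q i + ε i) atTop (𝓝 0) := by
      have := ((tendsto_inv_atTop_zero.comp hq_top).const_mul R).add hε0
      simpa [div_eq_mul_inv] using this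
    exact h3.eventually_lt_const zero_lt_one
  have hbig : ∀ᶠ i in atTop, ε i ≤ R / q i := by
    filter_upwards [hqε.eventually_lt_const hR] with i hi
    rw [le_div_iff₀ (hqpos i), mul_comm]
    exact hi.le
  refine tendsto_of_tendsto_of_tendsto_of_le_of_le' hl hu ?_ ?_
  · filter_upwards [hsmall, hbig] with i h3 h4
    have h5 := (hε i _ h3).2 h4
    have h6 := mul_le_mul_of_nonneg_left h5 (s i).coe_nonneg
    linarith
  · filter_upwards [hsmall] with i h3
    have h5 := (hε i _ h3).1
    have h6 := mul_le_mul_of_nonneg_left h5 (s i).coe_nonneg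
    linarith

end PoissonLimit

/-! ### The overlap of two balls as a function of their centres -/

section Overlap

variable {E : Type*} [NormedAddCommGroup E] [InnerProductSpace ℝ E] [FiniteDimensional ℝ E]
  [MeasurableSpace E] [BorelSpace E]

/-- The volume of the intersection of two balls of radius `T` whose centres differ by `v`. -/
noncomputable def ballOverlap (T : ℝ) (v : E) : ℝ :=
  (volume : Measure E).real (Metric.closedBall 0 T ∩ Metric.closedBall v T)

theorem ballOverlap_nonneg (T : ℝ) (v : E) : 0 ≤ ballOverlap T v := measureReal_nonneg

theorem volume_inter_closedBall (a b : E) (T : ℝ) :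
    (volume : Measure E).real (Metric.closedBall a T ∩ Metric.closedBall b T) =
      ballOverlap T (b - a) := by
  have h : (fun x ↦ a + x) ⁻¹' (Metric.closedBall a T ∩ Metric.closedBall b T) =
      Metric.closedBall 0 T ∩ Metric.closedBall (b - a) T := by
    ext x
    simp only [mem_preimage, mem_inter_iff, Metric.mem_closedBall, dist_eq_norm]
    rw [add_sub_cancel_left, sub_zero, show a + x - b = x - (b - a) by abel]
  rw [ballOverlap, ← h, measureReal_def, measureReal_def, measure_preimage_add]

theorem ballOverlap_smul {c : ℝ} (hc : 0 < c) (T : ℝ) (v : E) :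
    ballOverlap (c * T) (c • v) = c ^ Module.finrank ℝ E * ballOverlap T v := by
  have h : (fun x ↦ c • x) ⁻¹' (Metric.closedBall (0 : E) (c * T) ∩
      Metric.closedBall (c • v) (c * T)) = Metric.closedBall 0 T ∩ Metric.closedBall v T := by
    ext x
    simp only [mem_preimage, mem_inter_iff, Metric.mem_closedBall, dist_eq_norm, sub_zero,
      ← smul_sub, norm_smul, Real.norm_eq_abs, abs_of_pos hc]
    rw [mul_le_mul_iff_right₀ hc, mul_le_mul_iff_right₀ hc]
  have h2 := Measure.addHaar_preimage_smul (volume : Measure E) hc.ne'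
    (Metric.closedBall (0 : E) (c * T) ∩ Metric.closedBall (c • v) (c * T))
  rw [h] at h2
  rw [ballOverlap, ballOverlap, measureReal_def, measureReal_def, h2, ENNReal.toReal_mul,
    ENNReal.toReal_ofReal (abs_nonneg _), abs_of_pos (by positivity), ← mul_assoc,
    mul_inv_cancel₀ (by positivity), one_mul]

theorem ballOverlap_eq_symm (T : ℝ) (v : E) :
    ballOverlap T v = (volume : Measure E).real (Metric.closedBall (-((1 / 2 : ℝ) • v)) T ∩
      Metric.closedBall ((1 / 2 : ℝ) • v) T) := by
  rw [volume_inter_closedBall, sub_neg_eq_add, ← add_smul]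
  norm_num

theorem ballOverlap_linearIsometryEquiv (U : E ≃ₗᵢ[ℝ] E) (T : ℝ) (v : E) :
    ballOverlap T (U v) = ballOverlap T v := by
  have h : U ⁻¹' (Metric.closedBall 0 T ∩ Metric.closedBall (U v) T) =
      Metric.closedBall 0 T ∩ Metric.closedBall v T := by
    ext x
    simp only [mem_preimage, mem_inter_iff, Metric.mem_closedBall, dist_eq_norm, ← map_sub,
      sub_zero, U.norm_map]
  rw [ballOverlap, ballOverlap, measureReal_def, measureReal_def, ← h,
    U.measurePreserving.measure_preimage
      (measurableSet_closedBall.inter measurableSet_closedBall).nullMeasurableSet]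

/-- For l ≥ 1, x - w is the convex combination of x - lw and x + lw with weights (1 ± 1/l)/2. -/
theorem norm_sub_le_of_convex {x w : E} {T l : ℝ} (hl : 1 ≤ l)
    (h1 : ‖x - l • w‖ ≤ T) (h2 : ‖x + l • w‖ ≤ T) : ‖x - w‖ ≤ T := by
  have h : x - w = ((1 + l⁻¹) / 2) • (x - l • w) + ((1 - l⁻¹) / 2) • (x + l • w) := by
    have hl0 : l ≠ 0 := by linarith
    simp only [smul_sub, smul_add, smul_smul]
    have e1 : (1 + l⁻¹) / 2 * l = (l + 1) / 2 := by field_simp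
    have e2 : (1 - l⁻¹) / 2 * l = (l - 1) / 2 := by field_simp
    rw [e1, e2]
    module
  have hl1 : l⁻¹ ≤ 1 := inv_le_one_of_one_le₀ hl
  have hl0 : 0 < l⁻¹ := inv_pos.2 (by linarith)
  rw [h]
  refine (norm_add_le _ _).trans ?_
  rw [norm_smul, norm_smul, Real.norm_of_nonneg (by linarith), Real.norm_of_nonneg (by linarith)]
  nlinarith

/-- With the centres placed symmetrically at ±v/2, moving them apart along their line shrinks the
intersection as a set. -/
theorem ballOverlap_smul_le {T l : ℝ} (hl : 1 ≤ l) (v : E) :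
    ballOverlap T (l • v) ≤ ballOverlap T v := by
  rw [ballOverlap_eq_symm, ballOverlap_eq_symm T v]
  refine measureReal_mono ?_
    ((measure_mono inter_subset_left).trans_lt measure_closedBall_lt_top).ne
  rintro x ⟨h1, h2⟩
  rw [smul_comm, Metric.mem_closedBall, dist_eq_norm] at h1 h2
  rw [sub_neg_eq_add] at h1
  constructor
  · rw [Metric.mem_closedBall, dist_eq_norm]
    refine norm_sub_le_of_convex hl ?_ ?_
    · rwa [smul_neg, sub_neg_eq_add]
    · rwa [smul_neg, ← sub_eq_add_neg]
  · rw [Metric.mem_closedBall, dist_eq_norm]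
    exact norm_sub_le_of_convex hl h2 h1

/-- A reflection takes w to a multiple l v with l ≥ 1, which reduces the claim to parallel vectors.
Hence the overlap depends on the norm alone. -/
theorem ballOverlap_anti {T : ℝ} {v w : E} (h : ‖v‖ ≤ ‖w‖) :
    ballOverlap T w ≤ ballOverlap T v := by
  by_cases hv : v = 0
  · subst hv
    rw [ballOverlap, ballOverlap, inter_self]
    exact measureReal_mono inter_subset_left measure_closedBall_lt_top.ne
  have hv' : 0 < ‖v‖ := norm_pos_iff.2 hv
  set l := ‖w‖ / ‖v‖ with hl
  have hl1 : 1 ≤ l := (one_le_div hv').2 h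
  have hn : ‖w‖ = ‖l • v‖ := by
    rw [norm_smul, Real.norm_of_nonneg (by linarith), hl, div_mul_cancel₀ _ hv'.ne']
  have hU := Submodule.reflection_sub hn
  rw [← ballOverlap_linearIsometryEquiv (ℝ ∙ (w - l • v))ᗮ.reflection T w, hU]
  exact ballOverlap_smul_le hl1 v

theorem ballOverlap_eq_of_norm_eq {T : ℝ} {v w : E} (h : ‖v‖ = ‖w‖) :
    ballOverlap T v = ballOverlap T w :=
  le_antisymm (ballOverlap_anti h.ge) (ballOverlap_anti h.le)

theorem ballOverlap_eq_zero {T : ℝ} {v : E} (h : 2 * T < ‖v‖) : ballOverlap T v = 0 := by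
  have : Metric.closedBall (0 : E) T ∩ Metric.closedBall v T = ∅ := by
    ext x
    simp only [mem_inter_iff, Metric.mem_closedBall, mem_empty_iff_false, iff_false, not_and]
    intro h1 h2
    have := dist_triangle_left v 0 x
    rw [dist_zero_right, dist_comm x v] at this
    rw [dist_comm] at h2
    linarith
  rw [ballOverlap, this, measureReal_empty]

theorem ballOverlap_zero {T : ℝ} (hT : 0 ≤ T) : ballOverlap T (0 : E) =
    T ^ Module.finrank ℝ E * (volume : Measure E).real (Metric.ball 0 1) := by
  rw [ballOverlap, inter_self, Measure.addHaar_real_closedBall volume _ hT]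

/-- Replacing v by w loses at most a shell of thickness dist v w around the ball at w. -/
theorem ballOverlap_le_add {T : ℝ} (hT : 0 ≤ T) (v w : E) :
    ballOverlap T v ≤ ballOverlap T w + ((T + dist v w) ^ Module.finrank ℝ E -
      T ^ Module.finrank ℝ E) * (volume : Measure E).real (Metric.ball 0 1) := by
  have h1 : Metric.closedBall (0 : E) T ∩ Metric.closedBall v T ⊆
      (Metric.closedBall 0 T ∩ Metric.closedBall w T) ∪
        (Metric.closedBall w (T + dist v w) \ Metric.closedBall w T) := by
    rintro x ⟨hx0, hxv⟩
    by_cases hxw : x ∈ Metric.closedBall w T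
    · exact Or.inl ⟨hx0, hxw⟩
    · refine Or.inr ⟨?_, hxw⟩
      rw [Metric.mem_closedBall] at hxv ⊢
      linarith [dist_triangle x v w]
  have hfin (z : E) (r : ℝ) : (volume : Measure E) (Metric.closedBall z r) ≠ ⊤ :=
    measure_closedBall_lt_top.ne
  have hsub : Metric.closedBall w T ⊆ Metric.closedBall w (T + dist v w) :=
    Metric.closedBall_subset_closedBall (by linarith [dist_nonneg (x := v) (y := w)])
  refine (measureReal_mono h1 ?_).trans ((measureReal_union_le _ _).trans ?_)
  · exact (measure_union_lt_top ((measure_mono inter_subset_left).trans_lt (hfin 0 T).lt_top)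
      ((measure_mono sdiff_subset).trans_lt (hfin _ _).lt_top)).ne
  · rw [measureReal_sdiff hsub measurableSet_closedBall (hfin _ _), Measure.addHaar_real_closedBall volume _ hT,
      Measure.addHaar_real_closedBall volume w (by positivity), ballOverlap]
    linarith

theorem continuous_ballOverlap {T : ℝ} (hT : 0 ≤ T) : Continuous (ballOverlap T : E → ℝ) := by
  rw [continuous_iff_continuousAt]
  intro v
  have hc : Tendsto (fun w : E ↦ ((T + dist w v) ^ Module.finrank ℝ E -
      T ^ Module.finrank ℝ E) * (volume : Measure E).real (Metric.ball 0 1)) (𝓝 v) (𝓝 0) := by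
    have : Continuous fun w : E ↦ ((T + dist w v) ^ Module.finrank ℝ E -
      T ^ Module.finrank ℝ E) * (volume : Measure E).real (Metric.ball 0 1) := by fun_prop
    simpa using this.tendsto v
  refine tendsto_iff_dist_tendsto_zero.2 (squeeze_zero (fun _ ↦ dist_nonneg) (fun w ↦ ?_) hc)
  rw [Real.dist_eq, abs_le]
  have h1 := ballOverlap_le_add hT v w
  have h2 := ballOverlap_le_add hT w v
  rw [dist_comm] at h1
  constructor <;> linarith

/-- The overlap is the convolution of the indicator of a ball with itself, so by Tonelli its
integral is the squared volume. -/
theorem lintegral_ballOverlap {T : ℝ} (hT : 0 ≤ T) :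
    ∫⁻ v : E, ENNReal.ofReal (ballOverlap T v) = ENNReal.ofReal
      ((T ^ Module.finrank ℝ E * (volume : Measure E).real (Metric.ball 0 1)) ^ 2) := by
  have hfin (z : E) (r : ℝ) : (volume : Measure E) (Metric.closedBall z r) ≠ ⊤ :=
    measure_closedBall_lt_top.ne
  have h1 (v : E) : ENNReal.ofReal (ballOverlap T v) =
      ∫⁻ z in Metric.closedBall (0 : E) T, {p : E × E | dist p.1 p.2 ≤ T}.indicator 1 (v, z) := by
    rw [ballOverlap, ofReal_measureReal ((measure_mono inter_subset_left).trans_lt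
      (hfin 0 T).lt_top).ne, inter_comm, ← Measure.restrict_apply measurableSet_closedBall,
      ← lintegral_indicator_one measurableSet_closedBall]
    refine lintegral_congr fun z ↦ ?_
    by_cases h : dist v z ≤ T <;> simp [indicator, dist_comm z v, h]
  have hm : MeasurableSet {p : E × E | dist p.1 p.2 ≤ T} :=
    (isClosed_le continuous_dist continuous_const).measurableSet
  simp_rw [h1]
  rw [lintegral_lintegral_swap (f := fun v z ↦ {p : E × E | dist p.1 p.2 ≤ T}.indicator 1 (v, z))
    (measurable_one.indicator hm).aemeasurable]
  have h2 (z : E) : ∫⁻ v : E, {p : E × E | dist p.1 p.2 ≤ T}.indicator 1 (v, z) =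
      volume (Metric.closedBall (0 : E) T) := by
    rw [← Measure.addHaar_closedBall_center volume z T,
      ← lintegral_indicator_one measurableSet_closedBall]
    refine lintegral_congr fun v ↦ ?_
    by_cases h : dist v z ≤ T <;> simp [indicator, h]
  simp_rw [h2]
  rw [setLIntegral_const, ← Measure.addHaar_real_closedBall volume 0 hT, ENNReal.ofReal_pow measureReal_nonneg,
    ofReal_measureReal (hfin 0 T), sq]

end Overlap

/-! ### The L² inequality and its transport to charts -/

section Transport

variable {E : Type*} [NormedAddCommGroup E] [InnerProductSpace ℝ E] [FiniteDimensional ℝ E]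
  [MeasurableSpace E] [BorelSpace E]

/-- Comparison of a function `g` with the weighted sum of normalised indicator functions of balls
of radius `t`, by expanding the square of their `L²` distance. -/
theorem two_mul_sum_mul_le {J : Type*} [Fintype J] (z : J → E) {w : J → ℝ} (hw : ∀ j, 0 ≤ w j)
    {t η : ℝ} (ht : 0 < t) {g : E → ℝ} (hg : Continuous g) (hgc : HasCompactSupport g)
    (hη : ∀ x y, dist x y ≤ t → |g x - g y| ≤ η) :
    2 * ∑ j, w j * g (z j) ≤ (∫ x, g x ^ 2) +
      ((volume : Measure E).real (Metric.closedBall 0 t))⁻¹ ^ 2 *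
        ∑ j, ∑ k, w j * w k * ballOverlap t (z k - z j) + 2 * η * ∑ j, w j := by
  set V := (volume : Measure E).real (Metric.closedBall 0 t) with hV
  have hfin (a : E) : (volume : Measure E) (Metric.closedBall a t) ≠ ⊤ :=
    measure_closedBall_lt_top.ne
  have hVa (a : E) : (volume : Measure E).real (Metric.closedBall a t) = V := by
    rw [hV, measureReal_def, measureReal_def, Measure.addHaar_closedBall_center]
  have hVpos : 0 < V :=
    ENNReal.toReal_pos (Metric.measure_closedBall_pos _ _ ht).ne' (hfin 0)
  let B : J → Set E := fun j ↦ Metric.closedBall (z j) t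
  have hB (j : J) : MeasurableSet (B j) := measurableSet_closedBall
  have hgi : Integrable g := hg.integrable_of_hasCompactSupport hgc
  have hg2 : Integrable fun x ↦ g x ^ 2 := by
    have h1 : Continuous fun x ↦ g x ^ 2 := by fun_prop
    refine h1.integrable_of_hasCompactSupport (hgc.mono fun x hx ↦ ?_)
    rw [Function.mem_support] at hx ⊢
    exact fun h ↦ hx (by simp [h])
  let G : E → ℝ := fun x ↦ ∑ j, w j * V⁻¹ * (B j).indicator g x
  let F : E → ℝ := fun x ↦ ∑ j, ∑ k, w j * w k * V⁻¹ ^ 2 * (B j ∩ B k).indicator 1 x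
  have hGi : Integrable G := integrable_finsetSum _ fun j _ ↦ (hgi.indicator (hB j)).const_mul _
  have hInd (j k : J) : Integrable ((B j ∩ B k).indicator (1 : E → ℝ)) :=
    (integrable_indicator_iff ((hB j).inter (hB k))).2 (integrableOn_const
      ((measure_mono inter_subset_left).trans_lt (hfin (z j)).lt_top).ne)
  have hFi : Integrable F := integrable_finsetSum _ fun j _ ↦ integrable_finsetSum _ fun k _ ↦
    (hInd j k).const_mul _
  -- This is 2gf ≤ g² + f², where f is the smeared point density. The integral of f² is the sum of
  -- ball overlaps.
  have hpt (x : E) : 2 * G x ≤ g x ^ 2 + F x := by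
    let f : ℝ := ∑ j, w j * V⁻¹ * (B j).indicator 1 x
    have h1 : G x = g x * f := by
      simp only [G, f, Finset.mul_sum]
      refine Finset.sum_congr rfl fun j _ ↦ ?_
      by_cases hx : x ∈ B j <;> simp [hx]; ring
    have h2 : F x = f ^ 2 := by
      simp only [F, f, sq, Finset.sum_mul_sum]
      refine Finset.sum_congr rfl fun j _ ↦ Finset.sum_congr rfl fun k _ ↦ ?_
      by_cases hx : x ∈ B j <;> by_cases hy : x ∈ B k <;> simp [hx, hy]; ring
    rw [h1, h2]
    nlinarith [sq_nonneg (g x - f)]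
  have hint := integral_mono (hGi.const_mul 2) (hg2.add hFi) hpt
  have hF : ∫ x, F x = V⁻¹ ^ 2 * ∑ j, ∑ k, w j * w k * ballOverlap t (z k - z j) := by
    simp only [F, Finset.mul_sum]
    rw [integral_finsetSum _ fun j _ ↦ integrable_finsetSum _ fun k _ ↦ (hInd j k).const_mul _]
    refine Finset.sum_congr rfl fun j _ ↦ ?_
    rw [integral_finsetSum _ fun k _ ↦ (hInd j k).const_mul _]
    refine Finset.sum_congr rfl fun k _ ↦ ?_
    rw [integral_const_mul, integral_indicator_one ((hB j).inter (hB k)), volume_inter_closedBall]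
    ring
  -- On a ball of radius t, g differs from its value at the centre by at most η.
  have hG : ∑ j, w j * (g (z j) - η) ≤ ∫ x, G x := by
    simp only [G]
    rw [integral_finsetSum _ fun j _ ↦ (hgi.indicator (hB j)).const_mul _]
    refine Finset.sum_le_sum fun j _ ↦ ?_
    rw [integral_const_mul, integral_indicator (hB j), mul_assoc]
    refine mul_le_mul_of_nonneg_left ?_ (hw j)
    have h3 : ∫ x in B j, (g (z j) - η) ≤ ∫ x in B j, g x := by
      refine setIntegral_mono_on (integrableOn_const (hfin _)) hgi.integrableOn (hB j) fun x hx ↦ ?_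
      linarith [(abs_le.1 (hη x (z j) hx)).1]
    rw [setIntegral_const, smul_eq_mul, hVa] at h3
    rw [le_inv_mul_iff₀ hVpos]
    exact h3
  rw [integral_const_mul] at hint
  simp only [Pi.add_apply] at hint
  rw [integral_add hg2 hFi, hF] at hint
  simp only [mul_sub, Finset.sum_sub_distrib, ← Finset.sum_mul] at hG
  linarith

variable {X : Type*} [TopologicalSpace X] [T2Space X] [CompactSpace X] [MeasurableSpace X] [BorelSpace X]

/-- Transport of a function supported in the domain of a chart to the model space. -/
theorem exists_transport (ψ : OpenPartialHomeomorph X E) {σ : Measure X} [IsFiniteMeasure σ]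
    {r : ℝ≥0}
    (hψ : ∀ A ⊆ ψ.source, MeasurableSet A → volume (ψ '' A) ≤ r * σ A) {u : X → ℝ}
    (hu : Continuous u) (hus : tsupport u ⊆ ψ.source) :
    ∃ g : E → ℝ, Continuous g ∧ HasCompactSupport g ∧ (∀ x ∈ ψ.source, g (ψ x) = u x) ∧
      ∫ y, g y ^ 2 ≤ r * ∫ x, u x ^ 2 ∂σ := by
  classical
  let g : E → ℝ := ψ.target.indicator (u ∘ ψ.symm)
  let K : Set E := ψ '' tsupport u
  have hK : IsCompact K := (isClosed_tsupport u).isCompact.image_of_continuousOn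
    (ψ.continuousOn.mono hus)
  have hKt : K ⊆ ψ.target := by
    rintro _ ⟨x, hx, rfl⟩
    exact ψ.map_source (hus hx)
  have hgK (y : E) (hy : y ∉ K) : g y = 0 := by
    by_cases hyt : y ∈ ψ.target
    · simp only [g, indicator_of_mem hyt, Function.comp_apply]
      by_contra hne
      exact hy ⟨ψ.symm y, subset_tsupport u hne, ψ.right_inv hyt⟩
    · exact indicator_of_notMem hyt _
  have hgc : Continuous g := by
    rw [continuous_iff_continuousAt]
    intro y
    by_cases hyt : y ∈ ψ.target
    · have h1 : ContinuousAt (u ∘ ψ.symm) y := hu.continuousAt.comp (ψ.continuousAt_symm hyt)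
      refine h1.congr ?_
      filter_upwards [ψ.open_target.mem_nhds hyt] with x hx
      exact (indicator_of_mem hx _).symm
    · have h1 : g =ᶠ[𝓝 y] fun _ ↦ 0 := by
        filter_upwards [hK.isClosed.isOpen_compl.mem_nhds fun h ↦ hyt (hKt h)] with x hx
        exact hgK x hx
      exact continuousAt_const.congr h1.symm
  refine ⟨g, hgc, HasCompactSupport.intro hK fun y hy ↦ hgK y hy, fun x hx ↦ ?_, ?_⟩
  · simp only [g, indicator_of_mem (ψ.map_source hx), Function.comp_apply, ψ.left_inv hx]
  · have hT : MeasurableSet ψ.target := ψ.open_target.measurableSet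
    have hm : AEMeasurable ψ.symm (volume.restrict ψ.target) :=
      ψ.continuousOn_symm.aemeasurable hT
    -- A one-sided comparison suffices, since the integrand is a square.
    have hle : (volume.restrict ψ.target).map ψ.symm ≤ r • σ := by
      refine Measure.le_iff.2 fun A hA ↦ ?_
      rw [Measure.map_apply_of_aemeasurable hm hA, Measure.restrict_apply' hT, inter_comm]
      have h2 : ψ '' (ψ.source ∩ A) = ψ.target ∩ ψ.symm ⁻¹' A := ψ.image_source_inter_eq' A
      rw [← h2]
      refine (hψ _ inter_subset_left (ψ.open_source.measurableSet.inter hA)).trans ?_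
      exact mul_le_mul_right (measure_mono inter_subset_right) _
    have h3 : ∫ y, g y ^ 2 = ∫ x, u x ^ 2 ∂((volume.restrict ψ.target).map ψ.symm) := by
      have hu2 : Continuous fun x ↦ u x ^ 2 := by fun_prop
      rw [integral_map hm hu2.measurable.aestronglyMeasurable, ← integral_indicator hT]
      refine integral_congr_ae (Eventually.of_forall fun y ↦ ?_)
      by_cases hy : y ∈ ψ.target <;> simp [g, hy]
    have hi : Integrable (fun x ↦ u x ^ 2) (r • σ) :=
      (hu.pow 2).integrable_of_hasCompactSupport (HasCompactSupport.of_compactSpace _)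
    rw [h3]
    refine (integral_mono_measure hle (Eventually.of_forall fun x ↦ sq_nonneg _) hi).trans ?_
    rw [integral_smul_nnreal_measure, NNReal.smul_def, smul_eq_mul]

end Transport

/-! ### A quadratic partition of unity -/

section Partition

variable {d : ℕ} {X : Type*} [EMetricSpace X] [CompactSpace X] [MeasurableSpace X] [BorelSpace X]
  {σ : Measure X}

/-- A finite cover by almost Euclidean charts, with a subordinate quadratic partition of unity. -/
theorem LocallyAlmostEuclidean.exists_partition (hσ : LocallyAlmostEuclidean d σ) {r : ℝ≥0}
    (hr : 1 < r) :
    ∃ (s : Finset X) (ψ : s → OpenPartialHomeomorph X (EuclideanSpace ℝ (Fin d))) (χ : s → X → ℝ),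
      (∀ a, ∀ x ∈ (ψ a).source, ∀ y ∈ (ψ a).source, edist x y ≤ r * edist (ψ a x) (ψ a y)) ∧
      (∀ a, ∀ A ⊆ (ψ a).source, MeasurableSet A → volume (ψ a '' A) ≤ r * σ A) ∧
      (∀ a, Continuous (χ a)) ∧ (∀ a x, 0 ≤ χ a x) ∧ (∀ a, tsupport (χ a) ⊆ (ψ a).source) ∧
      ∀ x, ∑ a, χ a x ^ 2 = 1 := by
  choose ψ hx h1 _ h3 using fun x ↦ hσ x r hr
  obtain ⟨s, hs⟩ := isCompact_univ.elim_finite_subcover (fun x ↦ (ψ x).source)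
    (fun x ↦ (ψ x).open_source) fun x _ ↦ mem_iUnion.2 ⟨x, hx x⟩
  obtain ⟨p, hp⟩ := PartitionOfUnity.exists_isSubordinate isClosed_univ
    (fun a : s ↦ (ψ a).source) (fun a ↦ (ψ a).open_source) (by
      intro x hx
      obtain ⟨a, ha, hxa⟩ := mem_iUnion₂.1 (hs hx)
      exact mem_iUnion.2 ⟨⟨a, ha⟩, hxa⟩)
  -- Square roots of a partition of unity: the supports are unchanged and the squares sum to 1.
  refine ⟨s, fun a ↦ ψ a, fun a x ↦ √(p a x), fun a ↦ h1 a, fun a A hA hA' ↦ (h3 a A hA hA').2,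
    fun a ↦ (p a).continuous.sqrt, fun a x ↦ Real.sqrt_nonneg _, fun a ↦ ?_, fun x ↦ ?_⟩
  · refine (closure_mono ?_).trans (hp a)
    intro x hx
    rw [Function.mem_support] at hx ⊢
    intro h
    simp [h] at hx
  · simp_rw [Real.sq_sqrt (p.nonneg _ _)]
    rw [← finsum_eq_sum_of_fintype]
    exact p.sum_eq_one (mem_univ x)

end Partition

/-! ### Overlap test functions and the pair kernel -/

section TestFunction

variable {d : ℕ}

/-- The overlap of two balls as a test function of the distance of their centres. -/
theorem exists_overlap_test (hd : 0 < d) {A T : ℝ} (hA : 0 ≤ A) (hT : 0 ≤ T) :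
    ∃ h : C_c(ℝ≥0, ℝ≥0),
      ∀ v : EuclideanSpace ℝ (Fin d), (h ‖v‖₊ : ℝ) = A * ballOverlap T v := by
  have : Nonempty (Fin d) := ⟨⟨0, hd⟩⟩
  obtain ⟨e, he⟩ := exists_norm_eq (EuclideanSpace ℝ (Fin d)) zero_le_one
  have hne (τ : ℝ≥0) : ‖(τ : ℝ) • e‖ = τ := by
    rw [norm_smul, he, mul_one, Real.norm_of_nonneg τ.coe_nonneg]
  -- The overlap depends only on the norm, so sampling it along one unit vector determines it; d > 0
  -- provides that vector.
  let h : ℝ≥0 → ℝ≥0 := fun τ ↦ (A * ballOverlap T ((τ : ℝ) • e)).toNNReal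
  have hcont : Continuous h := by
    have := (continuous_ballOverlap (E := EuclideanSpace ℝ (Fin d)) hT)
    fun_prop
  have hcomp : HasCompactSupport h := by
    refine HasCompactSupport.intro (isCompact_Icc (a := 0) (b := (2 * T).toNNReal)) fun τ hτ ↦ ?_
    have h1 : 2 * T < τ := by
      rw [← Real.coe_toNNReal (2 * T) (by positivity), NNReal.coe_lt_coe]
      by_contra h2
      exact hτ ⟨zero_le, not_lt.1 h2⟩
    simp [h, ballOverlap_eq_zero (h1.trans_eq (hne τ).symm)]
  refine ⟨⟨⟨h, hcont⟩, hcomp⟩, fun v ↦ ?_⟩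
  change ((h ‖v‖₊ : ℝ≥0) : ℝ) = _
  simp only [h]
  rw [Real.coe_toNNReal _ (mul_nonneg hA (ballOverlap_nonneg _ _)),
    ballOverlap_eq_of_norm_eq (w := v) (by rw [hne]; rfl)]

/-- Since ω is the image of Lebesgue measure under the norm, this is the integral of the overlap
over ℝ^d. -/
theorem lintegral_overlap_test {A T : ℝ} (hA : 0 ≤ A) (hT : 0 ≤ T) {h : C_c(ℝ≥0, ℝ≥0)}
    (hh : ∀ v : EuclideanSpace ℝ (Fin d), (h ‖v‖₊ : ℝ) = A * ballOverlap T v) :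
    ∫⁻ τ, (h τ : ℝ≥0∞) ∂(poissonMeasure d) = ENNReal.ofReal (A * (T ^ d *
      (volume : Measure (EuclideanSpace ℝ (Fin d))).real (Metric.ball 0 1)) ^ 2) := by
  have hm : Measurable fun τ ↦ (h τ : ℝ≥0∞) := (ENNReal.continuous_coe.comp h.continuous).measurable
  rw [poissonMeasure, lintegral_map hm measurable_nnnorm]
  have h1 (v : EuclideanSpace ℝ (Fin d)) : (h ‖v‖₊ : ℝ≥0∞) =
      ENNReal.ofReal A * ENNReal.ofReal (ballOverlap T v) := by
    rw [← ENNReal.ofReal_mul hA, ← hh, ENNReal.ofReal_coe_nnreal]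
  simp_rw [h1]
  rw [lintegral_const_mul' _ _ ENNReal.ofReal_ne_top, lintegral_ballOverlap hT,
    ← ENNReal.ofReal_mul hA, finrank_euclideanSpace, Fintype.card_fin]

variable {X : Type*} [EMetricSpace X]

open scoped Classical in
theorem TriangularArray.lintegral_pairCorrelation (ξ : TriangularArray X) (s : ℝ≥0) (i : ℕ)
    (h : C_c(ℝ≥0, ℝ≥0)) :
    ∫⁻ τ, (h τ : ℝ≥0∞) ∂(ξ.pairCorrelation d s i) = ((s / (ξ.N i : ℝ≥0) ^ 2 *
      ∑ p : Fin (ξ.N i) × Fin (ξ.N i) with p.1 ≠ p.2 ∧ edist (ξ.pt i p.1) (ξ.pt i p.2) ≠ ⊤,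
        h (s ^ (1 / (d : ℝ)) * (edist (ξ.pt i p.1) (ξ.pt i p.2)).toNNReal) : ℝ≥0) : ℝ≥0∞) := by
  have hm : Measurable fun τ ↦ (h τ : ℝ≥0∞) := (ENNReal.continuous_coe.comp h.continuous).measurable
  rw [pairCorrelation, lintegral_smul_measure, lintegral_finsetSum_measure]
  simp_rw [lintegral_dirac' _ hm]
  push_cast
  rfl

/-- The kernel `h (s^(1/d) * dist (x, y))`, with value `0` for points at infinite distance. -/
noncomputable def pairKernel (d : ℕ) (s : ℝ≥0) (h : C_c(ℝ≥0, ℝ≥0)) (x y : X) : ℝ :=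
  open scoped Classical in
  if edist x y = ⊤ then 0 else h (s ^ (1 / (d : ℝ)) * (edist x y).toNNReal)

theorem pairKernel_nonneg (s : ℝ≥0) (h : C_c(ℝ≥0, ℝ≥0)) (x y : X) : 0 ≤ pairKernel d s h x y := by
  rw [pairKernel]
  split_ifs <;> simp

open scoped Classical in
-- The L² expansion sums over all pairs, whereas the pair correlation omits the diagonal; the
-- difference is N h(0).
theorem TriangularArray.sum_pairKernel (ξ : TriangularArray X) (s : ℝ≥0) (i : ℕ)
    (h : C_c(ℝ≥0, ℝ≥0)) :
    ∑ j, ∑ k, pairKernel d s h (ξ.pt i j) (ξ.pt i k) =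
      ((∑ p : Fin (ξ.N i) × Fin (ξ.N i) with p.1 ≠ p.2 ∧ edist (ξ.pt i p.1) (ξ.pt i p.2) ≠ ⊤,
        h (s ^ (1 / (d : ℝ)) * (edist (ξ.pt i p.1) (ξ.pt i p.2)).toNNReal) : ℝ≥0) : ℝ) +
      ξ.N i * h 0 := by
  have hdiag : (ξ.N i : ℝ) * h 0 = ∑ j : Fin (ξ.N i), ∑ k, if j = k then (h 0 : ℝ) else 0 := by
    simp
  rw [hdiag, ← Fintype.sum_prod_type', ← Fintype.sum_prod_type', Finset.sum_filter]
  push_cast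
  rw [← Finset.sum_add_distrib]
  refine Finset.sum_congr rfl fun p _ ↦ ?_
  rw [pairKernel]
  by_cases h1 : p.1 = p.2
  · simp [h1]
  · by_cases h2 : edist (ξ.pt i p.1) (ξ.pt i p.2) = ⊤ <;> simp [h1, h2]

end TestFunction

/-! ### The L² inequality for one chart -/

section Chart

variable {d : ℕ} {X : Type*} [EMetricSpace X]

/-- Dilating by r s^(1/d) turns balls of radius R s^(-1/d) into balls of radius rR and ‖v‖ into at
least s^(1/d) dist(x, y), so monotonicity of the overlap applies. The constant in h is what the
normalisation by the squared ball volume leaves. -/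
theorem ballOverlap_le_pairKernel (hd : 0 < d) {r R s : ℝ≥0} (hr : 0 < r) (hR : 0 < R) (hs : 0 < s)
    {V : ℝ} (hV : V = (volume : Measure (EuclideanSpace ℝ (Fin d))).real (Metric.ball 0 1))
    {h : C_c(ℝ≥0, ℝ≥0)}
    (hh : ∀ v : EuclideanSpace ℝ (Fin d), (h ‖v‖₊ : ℝ) =
      ((R : ℝ) ^ d * V ^ 2 * (r * R : ℝ) ^ d)⁻¹ * ballOverlap (r * R : ℝ) v)
    {x y : X} {v : EuclideanSpace ℝ (Fin d)} (hxy : edist x y ≤ r * ‖v‖₊) :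
    ((volume : Measure (EuclideanSpace ℝ (Fin d))).real
      (Metric.closedBall 0 (R / s ^ (1 / (d : ℝ)) : ℝ)))⁻¹ ^ 2 *
        ballOverlap (R / s ^ (1 / (d : ℝ)) : ℝ) v ≤ s * pairKernel d s h x y := by
  have : Nonempty (Fin d) := ⟨⟨0, hd⟩⟩
  have hVpos : 0 < V := hV ▸ ENNReal.toReal_pos (Metric.measure_ball_pos _ _ one_pos).ne'
    measure_ball_lt_top.ne
  have hne : edist x y ≠ ⊤ := (hxy.trans_lt (by finiteness)).ne
  set q : ℝ≥0 := s ^ (1 / (d : ℝ)) with hq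
  have hq0 : 0 < q := NNReal.rpow_pos hs
  have hqd : (q : ℝ) ^ d = s := by
    rw [hq, ← NNReal.coe_pow, ← NNReal.rpow_natCast, ← NNReal.rpow_mul, one_div,
      inv_mul_cancel₀ (by positivity), NNReal.rpow_one]
  have hq' : (s : ℝ) ^ (1 / (d : ℝ)) = q := by rw [hq, NNReal.coe_rpow]
  have hr' : (0 : ℝ) < r := hr
  have hR' : (0 : ℝ) < R := hR
  have hqr : (0 : ℝ) < q := hq0
  set τ : ℝ≥0 := q * (edist x y).toNNReal with hτ
  rw [pairKernel, if_neg hne, hq', ← hq, ← hτ]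
  obtain ⟨e, he⟩ := exists_norm_eq (EuclideanSpace ℝ (Fin d)) τ.coe_nonneg
  have he' : ‖e‖₊ = τ := NNReal.eq he
  rw [← he', hh]
  have hc : 0 < (r * q : ℝ)⁻¹ := by positivity
  have hT : (R : ℝ) / q = (r * q : ℝ)⁻¹ * (r * R) := by field_simp
  have hv : v = (r * q : ℝ)⁻¹ • ((r * q : ℝ) • v) := by
    rw [smul_smul, inv_mul_cancel₀ (by positivity), one_smul]
  have hle : ballOverlap (R / q : ℝ) v ≤ ((r * q : ℝ)⁻¹) ^ d * ballOverlap (r * R : ℝ) e := by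
    rw [hT, hv, ballOverlap_smul hc, finrank_euclideanSpace, Fintype.card_fin]
    refine mul_le_mul_of_nonneg_left (ballOverlap_anti ?_) (by positivity)
    rw [he, norm_smul, Real.norm_of_nonneg (by positivity), hτ]
    have h1 : (edist x y).toNNReal ≤ r * ‖v‖₊ := by
      rw [← ENNReal.coe_le_coe, ENNReal.coe_toNNReal hne]
      exact_mod_cast hxy
    have h2 : ((edist x y).toNNReal : ℝ) ≤ r * ‖v‖ := by exact_mod_cast h1
    push_cast
    calc (q : ℝ) * (edist x y).toNNReal ≤ q * (r * ‖v‖) := by gcongr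
      _ = _ := by ring
  rw [Measure.addHaar_real_closedBall volume _ (by positivity), finrank_euclideanSpace,
    Fintype.card_fin, ← hV]
  refine (mul_le_mul_of_nonneg_left hle (by positivity)).trans_eq ?_
  rw [← hqd]
  simp only [div_pow, mul_pow, inv_pow, mul_inv]
  field_simp

/-- One factor χ is put in the weights and the other in the function fχ, so the linear term carries
χ² and the pair sum carries χ(x)χ(y). -/
theorem two_mul_sum_mul_sq_le_pairKernel [MeasurableSpace X] (hd : 0 < d) {r R s : ℝ≥0}
    (hr : 0 < r) (hR : 0 < R) (hs : 0 < s)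
    {V : ℝ} (hV : V = (volume : Measure (EuclideanSpace ℝ (Fin d))).real (Metric.ball 0 1))
    {h : C_c(ℝ≥0, ℝ≥0)}
    (hh : ∀ v : EuclideanSpace ℝ (Fin d), (h ‖v‖₊ : ℝ) =
      ((R : ℝ) ^ d * V ^ 2 * (r * R : ℝ) ^ d)⁻¹ * ballOverlap (r * R : ℝ) v)
    {ψ : OpenPartialHomeomorph X (EuclideanSpace ℝ (Fin d))}
    (hψ : ∀ x ∈ ψ.source, ∀ y ∈ ψ.source, edist x y ≤ r * edist (ψ x) (ψ y))
    {f χ : X → ℝ} (hχ : ∀ x, 0 ≤ χ x) (hχ1 : ∀ x, χ x ≤ 1) (hχψ : tsupport χ ⊆ ψ.source)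
    {g : EuclideanSpace ℝ (Fin d) → ℝ} (hg : Continuous g) (hgc : HasCompactSupport g)
    (hgf : ∀ x ∈ ψ.source, g (ψ x) = f x * χ x) {η : ℝ}
    (hη : ∀ x y, dist x y ≤ (R / s ^ (1 / (d : ℝ)) : ℝ) → |g x - g y| ≤ η)
    {n : ℕ} (hn : 0 < n) (x : Fin n → X) :
    2 * ((1 / (n : ℝ)) * ∑ j, f (x j) * χ (x j) ^ 2) ≤ (∫ y, g y ^ 2) +
      s / (n : ℝ) ^ 2 * ∑ j, ∑ k, χ (x j) * χ (x k) * pairKernel d s h (x j) (x k) + 2 * η := by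
  have hn' : (0 : ℝ) < n := by exact_mod_cast hn
  have ht : (0 : ℝ) < R / s ^ (1 / (d : ℝ)) := by
    have : (0 : ℝ) < R := hR
    have : (0 : ℝ) < s := hs
    positivity
  have hη0 : 0 ≤ η := (abs_nonneg _).trans (hη 0 0 (by simpa using ht.le))
  have hsrc (y : X) (hy : χ y ≠ 0) : y ∈ ψ.source := hχψ (subset_tsupport χ hy)
  have key := two_mul_sum_mul_le (fun j ↦ ψ (x j)) (w := fun j ↦ χ (x j) / n)
    (fun j ↦ div_nonneg (hχ _) hn'.le) ht hg hgc hη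
  have h1 : ∑ j, χ (x j) / n * g (ψ (x j)) = (1 / (n : ℝ)) * ∑ j, f (x j) * χ (x j) ^ 2 := by
    rw [Finset.mul_sum]
    refine Finset.sum_congr rfl fun j _ ↦ ?_
    by_cases hj : χ (x j) = 0
    · simp [hj]
    · rw [hgf _ (hsrc _ hj)]
      ring
  have h2 : ∑ j, χ (x j) / n ≤ 1 := by
    rw [← Finset.sum_div, div_le_one hn']
    refine (Finset.sum_le_sum fun j _ ↦ hχ1 (x j)).trans_eq (by simp)
  have h3 : ((volume : Measure (EuclideanSpace ℝ (Fin d))).real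
      (Metric.closedBall 0 (R / s ^ (1 / (d : ℝ)) : ℝ)))⁻¹ ^ 2 *
        ∑ j, ∑ k, χ (x j) / n * (χ (x k) / n) *
          ballOverlap (R / s ^ (1 / (d : ℝ)) : ℝ) (ψ (x k) - ψ (x j)) ≤
      s / (n : ℝ) ^ 2 * ∑ j, ∑ k, χ (x j) * χ (x k) * pairKernel d s h (x j) (x k) := by
    simp only [Finset.mul_sum]
    refine Finset.sum_le_sum fun j _ ↦ Finset.sum_le_sum fun k _ ↦ ?_
    by_cases hj : χ (x j) = 0
    · simp [hj]
    by_cases hk : χ (x k) = 0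
    · simp [hk]
    have h4 := ballOverlap_le_pairKernel hd hr hR hs hV hh (x := x j) (y := x k)
      (v := ψ (x k) - ψ (x j)) (by
        rw [← enorm_eq_nnnorm, ← edist_eq_enorm_sub, edist_comm (ψ (x k))]
        exact hψ _ (hsrc _ hj) _ (hsrc _ hk))
    have h5 : 0 ≤ χ (x j) * χ (x k) / (n : ℝ) ^ 2 :=
      div_nonneg (mul_nonneg (hχ _) (hχ _)) (by positivity)
    calc _ = χ (x j) * χ (x k) / (n : ℝ) ^ 2 * (_ * _) := by ring
      _ ≤ _ := mul_le_mul_of_nonneg_left h4 h5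
      _ = _ := by ring
  simp only [h1] at key
  have h6 := mul_le_mul_of_nonneg_left h2 (by positivity : 0 ≤ 2 * η)
  linarith

end Chart

/-! ### A sub-Poisson limit implies equidistribution -/

section SubPoisson

variable {d : ℕ} {X : Type*} [EMetricSpace X] [CompactSpace X] [MeasurableSpace X] [BorelSpace X]
  {σ : Measure X} [IsProbabilityMeasure σ]

theorem eventually_two_mul_sum_le_of_partition (hd : 0 < d) {ξ : TriangularArray X} {s : ℕ → ℝ≥0}
    (hs0 : ∀ i, 0 < s i) (hs : Tendsto s atTop atTop) {r R : ℝ≥0} (hr : 0 < r) (hR : 0 < R)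
    {V : ℝ} (hV : V = (volume : Measure (EuclideanSpace ℝ (Fin d))).real (Metric.ball 0 1))
    {h : C_c(ℝ≥0, ℝ≥0)}
    (hh : ∀ v : EuclideanSpace ℝ (Fin d), (h ‖v‖₊ : ℝ) =
      ((R : ℝ) ^ d * V ^ 2 * (r * R : ℝ) ^ d)⁻¹ * ballOverlap (r * R : ℝ) v)
    {ψ : OpenPartialHomeomorph X (EuclideanSpace ℝ (Fin d))}
    (hψ : ∀ x ∈ ψ.source, ∀ y ∈ ψ.source, edist x y ≤ r * edist (ψ x) (ψ y))
    (hψv : ∀ A ⊆ ψ.source, MeasurableSet A → volume (ψ '' A) ≤ r * σ A)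
    {f χ : X → ℝ} (hf : Continuous f) (hχc : Continuous χ) (hχ : ∀ x, 0 ≤ χ x)
    (hχ1 : ∀ x, χ x ≤ 1) (hχψ : tsupport χ ⊆ ψ.source) {η : ℝ} (hη : 0 < η) :
    ∀ᶠ i in atTop, 2 * ((1 / (ξ.N i : ℝ)) * ∑ j, f (ξ.pt i j) * χ (ξ.pt i j) ^ 2) ≤
      r * (∫ x, (f x * χ x) ^ 2 ∂σ) + s i / (ξ.N i : ℝ) ^ 2 * (∑ j, ∑ k,
        χ (ξ.pt i j) * χ (ξ.pt i k) * pairKernel d (s i) h (ξ.pt i j) (ξ.pt i k)) + 2 * η := by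
  obtain ⟨g, hg, hgc, hgf, hgi⟩ := exists_transport (u := fun x ↦ f x * χ x) ψ hψv (hf.mul hχc)
    ((tsupport_mul_subset_right (f := f) (g := χ)).trans hχψ)
  obtain ⟨δ, hδ, hgδ⟩ := Metric.uniformContinuous_iff.1
    (hgc.uniformContinuous_of_continuous hg) η hη
  have ht : Tendsto (fun i ↦ (R : ℝ) / (s i : ℝ) ^ (1 / (d : ℝ))) atTop (𝓝 0) := by
    refine Tendsto.const_div_atTop ?_ _
    exact (tendsto_rpow_atTop (by positivity)).comp (NNReal.tendsto_coe_atTop.2 hs)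
  filter_upwards [ht.eventually (gt_mem_nhds hδ)] with i hi
  have := two_mul_sum_mul_sq_le_pairKernel hd hr hR (hs0 i) hV hh hψ hχ hχ1 hχψ hg hgc hgf
    (η := η) (fun x y hxy ↦ (hgδ (hxy.trans_lt hi)).le) (ξ.N_pos i) (ξ.pt i)
  linarith

/-- Sum of the chart inequalities: the terms χ_a² add up to 1 in the average and in ∫ f², and the
pair sums add up to at most the full pair sum, which is eventually below 1 + 2ε/5. -/
theorem eventually_two_mul_average_le (hd : 0 < d) (hσ : LocallyAlmostEuclidean d σ)
    {ξ : TriangularArray X} {s : ℕ → ℝ≥0} (hs0 : ∀ i, 0 < s i) (hs : Tendsto s atTop atTop)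
    (hsN : ∀ i, s i ≤ (ξ.N i : ℝ≥0))
    (hsub : HasSubPoissonLimit d (fun i ↦ ξ.pairCorrelation d (s i) i))
    {f : X → ℝ} (hf : Continuous f) {ε : ℝ} (hε : 0 < ε) :
    ∀ᶠ i in atTop, 2 * ((1 / (ξ.N i : ℝ)) * ∑ j, f (ξ.pt i j)) ≤ (∫ x, f x ^ 2 ∂σ) + 1 + ε := by
  classical
  have : Nonempty (Fin d) := ⟨⟨0, hd⟩⟩
  set Q := ∫ x, f x ^ 2 ∂σ with hQ
  set V := (volume : Measure (EuclideanSpace ℝ (Fin d))).real (Metric.ball 0 1) with hV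
  have hVpos : 0 < V := ENNReal.toReal_pos (Metric.measure_ball_pos _ _ one_pos).ne'
    measure_ball_lt_top.ne
  have hε5 : 0 < ε / 5 := by positivity
  obtain ⟨r, ⟨hrQ, hrd⟩, hr1⟩ : ∃ r : ℝ≥0, ((r : ℝ) * Q < Q + ε / 5 ∧ (r : ℝ) ^ d < 1 + ε / 5) ∧
      1 < r := by
    have h1 : Tendsto (fun r : ℝ≥0 ↦ (r : ℝ) * Q) (𝓝 1) (𝓝 Q) := by
      have : Continuous fun r : ℝ≥0 ↦ (r : ℝ) * Q := by fun_prop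
      simpa using this.tendsto 1
    have h2 : Tendsto (fun r : ℝ≥0 ↦ (r : ℝ) ^ d) (𝓝 1) (𝓝 1) := by
      have : Continuous fun r : ℝ≥0 ↦ (r : ℝ) ^ d := by fun_prop
      simpa using this.tendsto 1
    exact ((((h1.eventually (gt_mem_nhds (by linarith))).and
      (h2.eventually (gt_mem_nhds (by linarith)))).filter_mono
        (nhdsWithin_le_nhds (s := Ioi 1))).and self_mem_nhdsWithin).exists
  -- A large smearing radius makes the diagonal contribution h(0) = 1/(R^d V) small; s ≤ N bounds
  -- its coefficient by 1.
  obtain ⟨R, hRd, hR⟩ : ∃ R : ℝ≥0, ((R : ℝ) ^ d * V)⁻¹ < ε / 5 ∧ 0 < R := by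
    have h1 : Tendsto (fun R : ℝ≥0 ↦ ((R : ℝ) ^ d * V)⁻¹) atTop (𝓝 0) :=
      tendsto_inv_atTop_zero.comp (Tendsto.atTop_mul_const hVpos
        ((tendsto_pow_atTop hd.ne').comp (NNReal.tendsto_coe_atTop.2 tendsto_id)))
    exact ((h1.eventually (gt_mem_nhds hε5)).and (eventually_gt_atTop 0)).exists
  have hr0 : 0 < r := one_pos.trans hr1
  have hr' : (0 : ℝ) < r := hr0
  have hR' : (0 : ℝ) < R := hR
  -- With this constant, ω h = r^d, which is close to 1.
  obtain ⟨h, hh⟩ := exists_overlap_test hd (A := ((R : ℝ) ^ d * V ^ 2 * (r * R : ℝ) ^ d)⁻¹)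
    (T := (r * R : ℝ)) (by positivity) (by positivity)
  have hh0 : (h 0 : ℝ) = ((R : ℝ) ^ d * V)⁻¹ := by
    have := hh 0
    rw [nnnorm_zero, ballOverlap_zero (by positivity), finrank_euclideanSpace, Fintype.card_fin,
      ← hV] at this
    rw [this]
    field_simp
  have hlim : ∀ᶠ i in atTop, ∫⁻ τ, (h τ : ℝ≥0∞) ∂(ξ.pairCorrelation d (s i) i) <
      ENNReal.ofReal (1 + ε / 5) := by
    refine eventually_lt_of_limsup_lt ((hsub h).trans_lt ?_)
    rw [lintegral_overlap_test (by positivity) (by positivity) hh, ← hV]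
    refine (ENNReal.ofReal_lt_ofReal_iff (by positivity)).2 (lt_of_eq_of_lt ?_ hrd)
    rw [mul_pow]
    field_simp
  obtain ⟨S, ψ, χ, hψ, hψv, hχc, hχ0, hχψ, hχ⟩ := hσ.exists_partition hr1
  have hχ1 (a : S) (x : X) : χ a x ≤ 1 := by
    have h1 : χ a x ^ 2 ≤ 1 := by
      rw [← hχ x]
      exact Finset.single_le_sum (f := fun a ↦ χ a x ^ 2) (fun _ _ ↦ sq_nonneg _)
        (Finset.mem_univ a)
    exact (sq_le_one_iff₀ (hχ0 a x)).1 h1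
  -- From 2ab ≤ a² + b² and Σ χ_a² = 1.
  have hχχ (x y : X) : ∑ a, χ a x * χ a y ≤ 1 := by
    have h1 : ∑ a, 2 * (χ a x * χ a y) ≤ ∑ a, (χ a x ^ 2 + χ a y ^ 2) :=
      Finset.sum_le_sum fun a _ ↦ by nlinarith [sq_nonneg (χ a x - χ a y)]
    rw [Finset.sum_add_distrib, hχ, hχ, ← Finset.mul_sum] at h1
    linarith
  -- The oscillation errors 2η of all the charts together cost at most ε/5.
  set η : ℝ := ε / 10 / (Fintype.card S + 1) with hη
  have hη0 : 0 < η := by positivity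
  have hall := eventually_all.2 fun a ↦ eventually_two_mul_sum_le_of_partition (ξ := ξ) hd hs0 hs
    hr0 hR hV hh (hψ a) (hψv a) hf (hχc a) (hχ0 a) (hχ1 a) (hχψ a) hη0
  filter_upwards [hall, hlim] with i hi hρ
  have hN := ξ.N_pos_real i
  have hsum := Finset.sum_le_sum fun a (_ : a ∈ Finset.univ) ↦ hi a
  simp only [Finset.sum_add_distrib, ← Finset.mul_sum] at hsum
  have e1 : ∑ a, ∑ j, f (ξ.pt i j) * χ a (ξ.pt i j) ^ 2 = ∑ j, f (ξ.pt i j) := by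
    rw [Finset.sum_comm]
    simp only [← Finset.mul_sum, hχ, mul_one]
  have e2 : ∑ a, ∫ x, (f x * χ a x) ^ 2 ∂σ = Q := by
    rw [← integral_finsetSum]
    · simp only [mul_pow, ← Finset.mul_sum, hχ, mul_one, hQ]
    · intro a _
      have hc : Continuous fun x ↦ (f x * χ a x) ^ 2 := (hf.mul (hχc a)).pow 2
      exact hc.integrable_of_hasCompactSupport (HasCompactSupport.of_compactSpace _)
  have e3 : ∑ a, ∑ j, ∑ k, χ a (ξ.pt i j) * χ a (ξ.pt i k) *
      pairKernel d (s i) h (ξ.pt i j) (ξ.pt i k) ≤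
      ∑ j, ∑ k, pairKernel d (s i) h (ξ.pt i j) (ξ.pt i k) := by
    rw [Finset.sum_comm]
    refine Finset.sum_le_sum fun j _ ↦ ?_
    rw [Finset.sum_comm]
    refine Finset.sum_le_sum fun k _ ↦ ?_
    rw [← Finset.sum_mul]
    exact mul_le_of_le_one_left (pairKernel_nonneg _ _ _ _) (hχχ _ _)
  have e4 : (s i : ℝ) / (ξ.N i : ℝ) ^ 2 *
      ∑ j, ∑ k, pairKernel d (s i) h (ξ.pt i j) (ξ.pt i k) ≤ 1 + ε / 5 + ε / 5 := by
    rw [ξ.lintegral_pairCorrelation, ENNReal.ofReal, ENNReal.coe_lt_coe,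
      Real.lt_toNNReal_iff_coe_lt] at hρ
    rw [ξ.sum_pairKernel, mul_add]
    have h1 : (s i : ℝ) / (ξ.N i : ℝ) ^ 2 * (ξ.N i * h 0) ≤ ε / 5 := by
      have h2 : (s i : ℝ) / ξ.N i ≤ 1 := (div_le_one hN).2 (by exact_mod_cast hsN i)
      calc (s i : ℝ) / (ξ.N i : ℝ) ^ 2 * (ξ.N i * h 0) = s i / ξ.N i * h 0 := by field_simp
        _ ≤ h 0 := mul_le_of_le_one_left (NNReal.coe_nonneg _) h2
        _ ≤ ε / 5 := hh0.trans_le hRd.le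
    push_cast at hρ h1 ⊢
    linarith
  have e5 : ∑ _a : S, η ≤ ε / 10 := by
    rw [Finset.sum_const, Finset.card_univ, nsmul_eq_mul, hη, mul_div_assoc', div_le_iff₀ (by positivity)]
    nlinarith
  have e6 := mul_le_mul_of_nonneg_left e3 (by positivity : 0 ≤ (s i : ℝ) / (ξ.N i : ℝ) ^ 2)
  rw [e1, e2] at hsum
  linarith

/-- If the pair correlation measures have a sub-Poisson limit, then the array is equidistributed. -/
theorem equidistributed_of_hasSubPoissonLimit (hd : 0 < d) (hσ : LocallyAlmostEuclidean d σ)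
    {ξ : TriangularArray X} {s : ℕ → ℝ≥0} (hs0 : ∀ i, 0 < s i) (hs : Tendsto s atTop atTop)
    (hsN : ∀ i, s i ≤ (ξ.N i : ℝ≥0))
    (hsub : HasSubPoissonLimit d (fun i ↦ ξ.pairCorrelation d (s i) i)) :
    ξ.Equidistributed σ := by
  -- A one-sided bound suffices, since it applies to f - I and to I - f.
  have key {g : X → ℝ} (hg : Continuous g) (hg0 : ∫ x, g x ∂σ = 0) {ε : ℝ} (hε : 0 < ε) :
      ∀ᶠ i in atTop, (1 / (ξ.N i : ℝ)) * ∑ j, g (ξ.pt i j) < ε := by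
    set Q := ∫ x, g x ^ 2 ∂σ with hQ
    have hQ0 : 0 ≤ Q := integral_nonneg fun x ↦ sq_nonneg _
    -- For the function 1 + t g the inequality reads 2 + 2t avg g ≤ 2 + t²Q + tε, so avg g ≤ (tQ +
    -- ε)/2, and this choice gives tQ < ε.
    set t := ε / (Q + 1) with ht
    have ht0 : 0 < t := by positivity
    have hi1 : Integrable g σ :=
      hg.integrable_of_hasCompactSupport (HasCompactSupport.of_compactSpace _)
    have hi2 : Integrable (fun x ↦ g x ^ 2) σ := by
      have hc : Continuous fun x ↦ g x ^ 2 := hg.pow 2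
      exact hc.integrable_of_hasCompactSupport (HasCompactSupport.of_compactSpace _)
    have hsq : ∫ x, (1 + t * g x) ^ 2 ∂σ = 1 + t ^ 2 * Q := by
      have h1 (x : X) : (1 + t * g x) ^ 2 = 1 + 2 * t * g x + t ^ 2 * g x ^ 2 := by ring
      simp_rw [h1]
      have hi3 : Integrable (fun x ↦ 1 + 2 * t * g x) σ :=
        (integrable_const _).add (hi1.const_mul _)
      rw [integral_add hi3 (hi2.const_mul _),
        integral_add (integrable_const _) (hi1.const_mul _), integral_const_mul,
        integral_const_mul, hg0]
      simp [hQ]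
    filter_upwards [eventually_two_mul_average_le hd hσ hs0 hs hsN hsub
      (f := fun x ↦ 1 + t * g x) (by fun_prop) (mul_pos ht0 hε)] with i hi
    have hN := ξ.N_pos_real i
    have hav : (1 / (ξ.N i : ℝ)) * ∑ j, (1 + t * g (ξ.pt i j)) =
        1 + t * ((1 / (ξ.N i : ℝ)) * ∑ j, g (ξ.pt i j)) := by
      rw [Finset.sum_add_distrib, ← Finset.mul_sum]
      simp
      field_simp
    rw [hsq, hav] at hi
    have h2 : t * Q < ε := by
      rw [ht, div_mul_eq_mul_div, div_lt_iff₀ (by positivity)]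
      nlinarith
    have h3 : t * (2 * ((1 / (ξ.N i : ℝ)) * ∑ j, g (ξ.pt i j))) < t * (2 * ε) := by nlinarith
    linarith [lt_of_mul_lt_mul_left h3 ht0.le]
  intro f
  set I := ∫ x, f x ∂σ with hI
  have hfi : Integrable f σ := f.integrable σ
  have hzero : ∫ x, (f x - I) ∂σ = 0 := by
    rw [integral_sub hfi (integrable_const _)]
    simp [hI]
  have hzero' : ∫ x, (I - f x) ∂σ = 0 := by
    rw [integral_sub (integrable_const _) hfi]
    simp [hI]
  refine Metric.tendsto_nhds.2 fun ε hε ↦ ?_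
  filter_upwards [key (g := fun x ↦ f x - I) (f.continuous.sub continuous_const) hzero hε,
    key (g := fun x ↦ I - f x) (continuous_const.sub f.continuous) hzero' hε] with i h1 h2
  have hN := ξ.N_pos_real i
  have h3 : (1 / (ξ.N i : ℝ)) * ∑ _j : Fin (ξ.N i), I = I := by
    simp
    field_simp
  rw [Finset.sum_sub_distrib, mul_sub, h3] at h1 h2
  rw [Real.dist_eq, abs_lt]
  constructor <;> linarith

end SubPoisson

end PairCorrelation

theorem theorem2 {d : ℕ} (hd : 0 < d)
    {X : Type*} [EMetricSpace X] [CompactSpace X] [MeasurableSpace X] [BorelSpace X]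
    [ChartedSpace (EuclideanSpace ℝ (Fin d)) X] [IsManifold (𝓡 d) ∞ X]
    [RiemannianBundle (fun x : X ↦ TangentSpace (𝓡 d) x)]
    [IsContMDiffRiemannianBundle (𝓡 d) ∞ (EuclideanSpace ℝ (Fin d))
      (fun x : X ↦ TangentSpace (𝓡 d) x)]
    [IsRiemannianManifold (𝓡 d) X]
    (hvol : PairCorrelation.riemannianVolume d X Set.univ = 1)
    (ξ : PairCorrelation.TriangularArray X) :
    ((∃ s : ℕ → ℝ≥0, (∀ i, 0 < s i) ∧ Monotone s ∧ Tendsto s atTop atTop ∧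
        (∀ i, s i ≤ (ξ.N i : ℝ≥0)) ∧
        PairCorrelation.HasSubPoissonLimit d (fun i ↦ ξ.pairCorrelation d (s i) i)) →
      ξ.Equidistributed (PairCorrelation.riemannianVolume d X)) ∧
    (ξ.Equidistributed (PairCorrelation.riemannianVolume d X) →
      ∃ s : ℕ → ℝ≥0, (∀ i, 0 < s i) ∧ StrictMono s ∧ Tendsto s atTop atTop ∧
        (∀ i, s i ≤ (ξ.N i : ℝ≥0)) ∧
        PairCorrelation.HasPoissonLimit d (fun i ↦ ξ.pairCorrelation d (s i) i)) := by
  have := PairCorrelation.isContinuousRiemannianBundle_of_isContMDiff (d := d) (X := X)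
  have hσ : PairCorrelation.LocallyAlmostEuclidean d (PairCorrelation.riemannianVolume d X) :=
    PairCorrelation.locallyAlmostEuclidean_riemannianVolume
  have : IsProbabilityMeasure (PairCorrelation.riemannianVolume d X) := ⟨hvol⟩
  refine ⟨?_, fun h ↦ h.exists_hasPoissonLimit hd hσ⟩
  rintro ⟨s, hs0, -, hs, hsN, hsub⟩
  exact PairCorrelation.equidistributed_of_hasSubPoissonLimit hd hσ hs0 hs hsN hsub
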